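/- Notation. For $e\in\mathbb F_2^n$ let $X^e$, $Z^e$ be the tensor products of Pauli $X$ (resp. $Z$) on the positions with $e_i=1$ and the identity elsewhere. A CSS code $\mathcal C$ on $n$ qubits is given by finite sets $H_x,H_z\subseteq\mathbb F_2^n$ of checks spanning subspaces $S_x\perp S_z$; its code space is $V=\{\psi\in(\mathbb C^2)^{\otimes n}: X^x\psi=\psi\ \forall x\in S_x,\ Z^z\psi=\psi\ \forall z\in S_z\}$, it has $k=\dim_{\mathbb F_2}(S_x^\perp/S_z)$ logical qubits, and minimum distance $\Delta_{\min}=\min\{|w| : w\in (S_x^\perp\setminus S_z)\cup(S_z^\perp\setminus S_x)\}$. Its code Hamiltonian is $$H(\mathcal C)=\frac1{2|H_x|}\sum_{e\in H_x}\frac{I-X^e}2+\frac1{2|H_z|}\sum_{e\in H_z}\frac{I-Z^e}2$$ (a sum over an empty set is $0$). For a subspace $V$ let $V_t$ be the span of all $(A_1\otimes\dots\otimes A_n)\psi$ with $\psi\in V$ and at most $t$ of the one-qubit operators $A_i$ different from $I$, let $\Pi_{V_t}$ be the orthogonal projection onto $V_t$, and $D_V=\sum_{t\ge1}t(\Pi_{V_t}-\Pi_{V_{t-1}})$.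 The code $\mathcal C$ is $(q,\rho)$-quantum locally testable if, for a list $T_1,\dots,T_m$ of its check projections $\frac{I-X^e}2$ ($e\in H_x$) and $\frac{I-Z^e}2$ ($e\in H_z$), in which all $X$-checks occur equally often and all $Z$-checks occur equally often (at least once each), every $T_i$ acts on at most $q$ qubits, $V$ is the common kernel of the $T_i$, and $\frac1m\sum_{i=1}^m T_i\succeq\frac{\rho}{n}D_V$. A circuit of depth $d$ is a product of $d$ layers, each a tensor product of two-qubit unitary gates on disjoint, otherwise arbitrary, pairs of qubits. An $n$-qubit state is depth-$d$ trivial if it is obtained by applying a depth-$d$ circuit to $|0\rangle^{\otimes N}$ for some $N\ge n$ and tracing out $N-n$ qubits. A Hamiltonian is $k$-local if it equals $\frac1m\sum_{i=1}^m h_i$ with $0\preceq h_i\preceq I$ and every $h_i$ acting on at most $k$ qubits. A family $(H_i)_{i\in\mathbb N}$ of Hamiltonians on $n_i\to\infty$ qubits, all $k$-local for one constant $k$, is $\varepsilon$-NLTS if for every constant $d$ and every family $(\sigma_i)$ of $n_i$-qubit states that are depth-$d$ trivial for all large $i$, $\operatorname{tr}[\sigma_iH_i]>\lambda_{\min}(H_i)+\varepsilon$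 for all sufficiently large $i$; it is NLTS if it is $\varepsilon$-NLTS for some constant $\varepsilon>0$. **Theorem.** For all constants $\rho,\delta>0$ there are constants $\varepsilon>0$ and $c>0$ such that the following holds. Let $q$ be a constant and let $(\mathcal C_i)_{i\in\mathbb N}$ be a family of $(q,\rho)$-quantum locally testable CSS codes on $n_i\to\infty$ qubits, each with $k\ge1$ logical qubits, and with $\Delta_{\min}(\mathcal C_i)\ge\delta n_i$ for all sufficiently large $i$. Then the family $H(\mathcal C_i)$ is $\varepsilon$-NLTS, hence NLTS. Moreover, for all sufficiently large $i$, every depth-$d$ trivial $n_i$-qubit state $\sigma$ with $\operatorname{tr}[\sigma H(\mathcal C_i)]\le\lambda_{\min}(H(\mathcal C_i))+\varepsilon$ has $d\ge c\log n_i$. -/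

import Mathlib

open Filter Topology
open scoped Matrix ComplexOrder

noncomputable section

namespace QCode

/-! ### Qubit registers, operators, locality -/

/-- Bit strings on a register `Q` of qubits; they label the computational basis. -/
abbrev Bits (Q : Type) : Type := Q → ZMod 2

/-- Pure state vectors on the register `Q`: the space `(ℂ²)^{⊗ Q}` in the computational basis. -/
abbrev Vec (Q : Type) [Fintype Q] [DecidableEq Q] : Type := EuclideanSpace ℂ (Bits Q)

/-- Operators on the register `Q`, as matrices in the computational basis. -/
abbrev Op (Q : Type) : Type := Matrix (Bits Q) (Bits Q) ℂ

/-- The restriction of a bit string to a set of qubits. -/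
def restrict {Q : Type} (x : Bits Q) (S : Finset Q) : Bits S := fun q => x q

section Register

variable {Q : Type} [Fintype Q] [DecidableEq Q]

/-- The action of an operator on a state vector. -/
def apply (A : Op Q) (ψ : Vec Q) : Vec Q := Matrix.toEuclideanCLM (𝕜 := ℂ) A ψ

/-- The tensor product `⨂ i, A i` of one-qubit operators. -/
def tensor (A : Q → Matrix (ZMod 2) (ZMod 2) ℂ) : Op Q :=
  Matrix.of fun x y => ∏ i, A i (x i) (y i)

/-- `A = h ⊗ I`, where `h` acts on the qubits of `S` and `I` is the identity on the others. -/
def ActsOn (S : Finset Q) (A : Op Q) : Prop :=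
  ∃ h : Op S, ∀ x y : Bits Q,
    A x y = if ∀ q, q ∉ S → x q = y q then h (restrict x S) (restrict y S) else 0

/-- `A` acts nontrivially on at most `k` qubits. -/
def IsLocal (k : ℕ) (A : Op Q) : Prop := ∃ S : Finset Q, S.card ≤ k ∧ ActsOn S A

/-- `H` is an average `(1/m) ∑ hᵢ` of `k`-local terms with `0 ≤ hᵢ ≤ I`. -/
def IsLocalHamiltonian (k : ℕ) (H : Op Q) : Prop :=
  ∃ (m : ℕ) (h : Fin m → Op Q),
    (∀ i, (h i).PosSemidef ∧ (1 - h i).PosSemidef ∧ IsLocal k (h i)) ∧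
      H = (1 / (m : ℝ)) • ∑ i, h i

/-- The least eigenvalue of a Hermitian operator. -/
def lambdaMin (H : Op Q) : ℝ := sInf (spectrum ℝ H)

/-- The energy `tr[σ H]` of the state `σ`. -/
def energy (H σ : Op Q) : ℝ := (σ * H).trace.re

/-! ### Quantum circuits and trivial states -/

/-- One layer of a circuit: a tensor product of two-qubit unitary gates on pairwise disjoint pairs
of qubits (an arbitrary set `P` of pairs), with the identity on the remaining qubits. -/
def IsLayer (U : Op Q) : Prop :=
  ∃ (P : Finset (Finset Q)) (g : ∀ e : Finset Q, Op e),
    (∀ e ∈ P, e.card = 2) ∧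
    (∀ e ∈ P, ∀ f ∈ P, e ≠ f → Disjoint e f) ∧
    (∀ e ∈ P, g e ∈ Matrix.unitaryGroup (Bits e) ℂ) ∧
    ∀ x y : Bits Q, U x y =
      if ∀ q, (∀ e ∈ P, q ∉ e) → x q = y q
        then ∏ e ∈ P, g e (restrict x e) (restrict y e) else 0

/-- A circuit of depth `d`: a product of `d` layers. -/
def IsCircuit (d : ℕ) (U : Op Q) : Prop :=
  ∃ L : List (Op Q), L.length = d ∧ (∀ A ∈ L, IsLayer A) ∧ U = L.prod

/-- The projector onto the all-zero computational basis state. -/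
def zeroState (Q : Type) [DecidableEq Q] [Fintype Q] : Op Q :=
  Matrix.single (0 : Bits Q) (0 : Bits Q) (1 : ℂ)

end Register

/-- The partial trace over the second register. -/
def traceOut {Q R : Type} [Fintype R] [DecidableEq R] (M : Op (Q ⊕ R)) : Op Q :=
  Matrix.of fun x y => ∑ w : Bits R, M (Sum.elim x w) (Sum.elim y w)

/-- The `n`-qubit states that a circuit of depth `d` prepares from `|0⟩^{⊗ (n + a)}`, for some
number `a` of ancilla qubits that are traced out at the end. -/
def IsTrivialState {n : ℕ} (d : ℕ) (σ : Op (Fin n)) : Prop :=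
  ∃ (a : ℕ) (U : Op (Fin n ⊕ Fin a)),
    IsCircuit d U ∧ σ = traceOut (U * zeroState (Fin n ⊕ Fin a) * Uᴴ)

/-- `ε`-NLTS (no low-energy trivial states) for a family of Hamiltonians `H i` on `n i → ∞`
qubits: the `H i` are `k`-local for a common `k`, and for every constant depth `d`, every family of
depth-`d` trivial states eventually has energy more than `ε` above the ground energy. -/
def IsNLTSWith (ε : ℝ) {n : ℕ → ℕ} (H : ∀ i, Op (Fin (n i))) : Prop :=
  Tendsto n atTop atTop ∧
  (∃ k : ℕ, ∀ i, IsLocalHamiltonian k (H i)) ∧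
  ∀ (d : ℕ) (σ : ∀ i, Op (Fin (n i))), (∀ᶠ i in atTop, IsTrivialState d (σ i)) →
    ∀ᶠ i in atTop, lambdaMin (H i) + ε < energy (H i) (σ i)

/-! ### The distance operator of a subspace, quantum locally testable codes -/

section Testable

variable {Q : Type} [Fintype Q] [DecidableEq Q]

/-- The `t`-fattening of `V`: the span of the vectors `(⨂ i, A i) ψ` with `ψ ∈ V` and at most `t`
of the one-qubit operators `A i` different from the identity. -/
def fattening (V : Submodule ℂ (Vec Q)) (t : ℕ) : Submodule ℂ (Vec Q) :=
  Submodule.span ℂ {φ | ∃ (A : Q → Matrix (ZMod 2) (ZMod 2) ℂ) (ψ : Vec Q),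
    ψ ∈ V ∧ {i | A i ≠ 1}.ncard ≤ t ∧ φ = apply (tensor A) ψ}

/-- The matrix of the orthogonal projection onto `V`. -/
def projMatrix (V : Submodule ℂ (Vec Q)) : Op Q :=
  (Matrix.toEuclideanCLM (n := Bits Q) (𝕜 := ℂ)).symm V.starProjection

/-- The distance operator `D_V = ∑_{t ≥ 1} t (Π_{V_t} - Π_{V_{t-1}})`. The fattenings are constant
from `t = |Q|` on, so that the sum stops there. -/
def distanceOp (V : Submodule ℂ (Vec Q)) : Op Q :=
  ∑ t ∈ Finset.Icc 1 (Fintype.card Q),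
    (t : ℝ) • (projMatrix (fattening V t) - projMatrix (fattening V (t - 1)))

/-- The code `V` is a `(q, ρ)`-quantum locally testable code with the list `T` of checks: the
checks are `q`-local projections, the code consists of the vectors that satisfy all of them, and
`(1/m) ∑ Tᵢ ≥ (ρ/|Q|) D_V` for the number `m` of checks. -/
structure IsQLTC {ι : Type} [Fintype ι] (q : ℕ) (ρ : ℝ) (V : Submodule ℂ (Vec Q))
    (T : ι → Op Q) : Prop where
  projection : ∀ i, IsStarProjection (T i)
  isLocal : ∀ i, IsLocal q (T i)
  mem_iff : ∀ ψ : Vec Q, ψ ∈ V ↔ ∀ i, apply (T i) ψ = 0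
  sound : ((1 / (Fintype.card ι : ℝ)) • ∑ i, T i
    - (ρ / (Fintype.card Q : ℝ)) • distanceOp V).PosSemidef

end Testable

/-! ### CSS codes -/

/-- The Pauli matrix `X`. -/
def pauliX : Matrix (ZMod 2) (ZMod 2) ℂ := Matrix.of fun a b => if a = b then 0 else 1

/-- The Pauli matrix `Z`. -/
def pauliZ : Matrix (ZMod 2) (ZMod 2) ℂ := Matrix.diagonal fun a => if a = 0 then 1 else -1

/-- `X^e`. -/
def xOp {n : ℕ} (e : Bits (Fin n)) : Op (Fin n) :=
  tensor fun i => if e i = 0 then 1 else pauliX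

/-- `Z^e`. -/
def zOp {n : ℕ} (e : Bits (Fin n)) : Op (Fin n) :=
  tensor fun i => if e i = 0 then 1 else pauliZ

/-- The dual `S^⊥` of a binary linear code. -/
def dual {n : ℕ} (S : Submodule (ZMod 2) (Bits (Fin n))) : Submodule (ZMod 2) (Bits (Fin n)) where
  carrier := {x | ∀ w ∈ S, w ⬝ᵥ x = 0}
  zero_mem' := fun w _ => dotProduct_zero w
  add_mem' := fun {a b} ha hb w hw => by rw [dotProduct_add, ha w hw, hb w hw, add_zero]
  smul_mem' := fun c a ha w hw => by rw [dotProduct_smul, ha w hw, smul_zero]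

/-- A CSS code on `n` qubits, given by its sets `Hx`, `Hz` of checks. The sets generate the
subspaces `S_x` and `S_z`, which are orthogonal. -/
structure CSSCode (n : ℕ) where
  Hx : Finset (Bits (Fin n))
  Hz : Finset (Bits (Fin n))
  orthogonal : ∀ x ∈ Hx, ∀ z ∈ Hz, x ⬝ᵥ z = 0

namespace CSSCode

variable {n : ℕ} (C : CSSCode n)

/-- The subspace `S_x` generated by the `X`-checks. -/
def Sx : Submodule (ZMod 2) (Bits (Fin n)) := Submodule.span (ZMod 2) (C.Hx : Set (Bits (Fin n)))

/-- The subspace `S_z` generated by the `Z`-checks. -/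
def Sz : Submodule (ZMod 2) (Bits (Fin n)) := Submodule.span (ZMod 2) (C.Hz : Set (Bits (Fin n)))

/-- The code space: the vectors fixed by all `X^x`, `x ∈ S_x`, and all `Z^z`, `z ∈ S_z`. -/
def codeSpace : Submodule ℂ (Vec (Fin n)) where
  carrier := {ψ | (∀ x ∈ C.Sx, apply (xOp x) ψ = ψ) ∧ ∀ z ∈ C.Sz, apply (zOp z) ψ = ψ}
  zero_mem' := ⟨fun _ _ => map_zero _, fun _ _ => map_zero _⟩
  add_mem' := fun {a b} ha hb =>
    ⟨fun x hx => (map_add _ a b).trans (congrArg₂ (· + ·) (ha.1 x hx) (hb.1 x hx)),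
      fun z hz => (map_add _ a b).trans (congrArg₂ (· + ·) (ha.2 z hz) (hb.2 z hz))⟩
  smul_mem' := fun c a ha =>
    ⟨fun x hx => (map_smul _ c a).trans (congrArg (c • ·) (ha.1 x hx)),
      fun z hz => (map_smul _ c a).trans (congrArg (c • ·) (ha.2 z hz))⟩

/-- The number `k` of logical qubits: the dimension of `S_x^⊥ / S_z` over the field with two
elements, that is, the binary logarithm of its cardinality. -/
def logicalQubits : ℕ :=
  Module.finrank (ZMod 2) (dual C.Sx ⧸ C.Sz.submoduleOf (dual C.Sx))

/-- The minimum distance: the least weight of a vector in `S_x^⊥ - S_z` or in `S_z^⊥ - S_x`. -/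
def minDistance : ℕ :=
  sInf {t | ∃ w : Bits (Fin n),
    ((w ∈ dual C.Sx ∧ w ∉ C.Sz) ∨ (w ∈ dual C.Sz ∧ w ∉ C.Sx)) ∧ hammingNorm w = t}

/-- The check projection `(I - X^e)/2`. -/
def xCheck (e : Bits (Fin n)) : Op (Fin n) := (1 / 2 : ℝ) • (1 - xOp e)

/-- The check projection `(I - Z^e)/2`. -/
def zCheck (e : Bits (Fin n)) : Op (Fin n) := (1 / 2 : ℝ) • (1 - zOp e)

/-- The code Hamiltonian: the `X`-checks and the `Z`-checks have total weight `1/2` each. -/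
def hamiltonian : Op (Fin n) :=
  (1 / (2 * (C.Hx.card : ℝ))) • ∑ e ∈ C.Hx, xCheck e +
    (1 / (2 * (C.Hz.card : ℝ))) • ∑ e ∈ C.Hz, zCheck e

/-- The list of the check projections of the code, in which every `X`-check stands `a` times and
every `Z`-check stands `b` times. -/
def checkList (a b : ℕ) : (C.Hx × Fin a) ⊕ (C.Hz × Fin b) → Op (Fin n) :=
  Sum.elim (fun e => xCheck e.1.1) (fun e => zCheck e.1.1)

/-- The CSS code is a `(q, ρ)`-quantum locally testable code with its own checks. All checks may be
taken equally often (`a = b = 1`), or so often that the average of the list is the code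
Hamiltonian (`a = |Hz|`, `b = |Hx|`), or with other multiplicities of the two types. -/
def IsLocallyTestable (q : ℕ) (ρ : ℝ) : Prop :=
  ∃ a b : ℕ, 0 < a ∧ 0 < b ∧ IsQLTC q ρ C.codeSpace (C.checkList a b)

end CSSCode

end QCode

end

/-! Two facts about a shallow state collide with the uncertainty principle for a pair of
anticommuting logical operators.

Energy controls distance. Local testability bounds the distance operator by the Hamiltonian, so a
state of energy below a small constant has almost all its weight in the fattening `V_t` with `t`
about `δ n / 4` (`le_expect_distanceOp`, `IsLocallyTestable.distanceOp_le`). As `2 t` is below the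
minimum distance, errors of weight `t` can still be decoded: there are `±1`-valued observables
`decodeSign` and `decodeSignX`, one diagonal in the computational basis and one in the Hadamard
basis, that preserve `V_t` and act on it like logical `Z` and `X` beneath the errors. In particular
they anticommute on `V_t`.

Shallow circuits concentrate. If light cones have size at most `b`, a 1-Lipschitz function of the
`n` output bits has variance at most `n b ^ 2` (`HasLightCones.variance_le`), so two sets of
outcomes at distance of order `n` cannot both carry much mass. The strings decoding to `0` and to
`1` are such sets, and near `V_t` they exhaust almost all the mass; hence the decoded `Z`-value is
almost deterministic. A layer of Hadamard gates does not enlarge light cones, so the same argument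
for the code with `X` and `Z` exchanged makes the decoded `X`-value almost deterministic
(`le_sq_sum_expect_decodeSign`).

Anticommuting observables cannot both be nearly certain (`expect_add_le_of_anticommute`), so a
shallow state is a constant away from `V_t` (`lt_sum_dist_fattening`) and has constant energy. The
argument works as long as `4 ^ d` is at most a small multiple of `n`, which gives the logarithmic
depth bound. -/

set_option linter.unusedSectionVars false

namespace QCode

/-! ### Light cones of circuits. -/

section LightCone

variable {Q : Type} [Fintype Q] [DecidableEq Q]

/-- Entries of a product of two operators that are diagonal off disjoint regions. -/
theorem mul_apply_of_disjoint {S T : Finset Q} (hST : Disjoint S T) {A B : Op Q}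
    (hA : ∀ x y, (∃ q, q ∉ S ∧ x q ≠ y q) → A x y = 0)
    (hB : ∀ x y, (∃ q, q ∉ T ∧ x q ≠ y q) → B x y = 0) (x y : Bits Q) :
    (A * B) x y = A x (S.piecewise y x) * B (S.piecewise y x) y := by
  rw [Matrix.mul_apply]
  refine Finset.sum_eq_single _ (fun w _ hw => ?_) (by simp)
  obtain ⟨q, hq⟩ := Function.ne_iff.mp hw
  by_cases h : q ∈ S
  · rw [hB w y ⟨q, Finset.disjoint_left.mp hST h, by simpa [h] using hq⟩, mul_zero]
  · rw [hA x w ⟨q, h, by simpa [h, eq_comm] using hq⟩, zero_mul]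

/-- The operator `h ⊗ I`. -/
noncomputable def embed (S : Finset Q) (h : Op S) : Op Q :=
  Matrix.of fun x y => if ∀ q, q ∉ S → x q = y q then h (restrict x S) (restrict y S) else 0

theorem embed_apply (S : Finset Q) (h : Op S) (x y : Bits Q) :
    embed S h x y = if ∀ q, q ∉ S → x q = y q then h (restrict x S) (restrict y S) else 0 := rfl

theorem actsOn_embed (S : Finset Q) (h : Op S) : ActsOn S (embed S h) := ⟨h, fun _ _ => rfl⟩

theorem actsOn_iff {S : Finset Q} {A : Op Q} : ActsOn S A ↔ ∃ h, A = embed S h :=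
  ⟨fun ⟨h, hA⟩ => ⟨h, Matrix.ext hA⟩, fun ⟨h, hA⟩ => hA ▸ actsOn_embed S h⟩

theorem embed_apply_eq_zero {S : Finset Q} (h : Op S) (x y : Bits Q)
    (hxy : ∃ q, q ∉ S ∧ x q ≠ y q) : embed S h x y = 0 := by
  obtain ⟨q, hq, hne⟩ := hxy
  exact if_neg fun H => hne (H q hq)

theorem restrict_congr {S : Finset Q} {x y : Bits Q} (h : ∀ q ∈ S, x q = y q) :
    restrict x S = restrict y S := funext fun q => h q q.2

theorem embed_apply_piecewise {S : Finset Q} (h : Op S) (x y : Bits Q) :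
    embed S h x (S.piecewise y x) = h (restrict x S) (restrict y S) := by
  rw [embed_apply, if_pos fun q hq => by simp [hq]]
  rw [restrict_congr (x := S.piecewise y x) (y := y) fun q hq => by simp [hq]]

theorem ActsOn.commute {S T : Finset Q} {A B : Op Q} (hA : ActsOn S A) (hB : ActsOn T B)
    (hST : Disjoint S T) : Commute A B := by
  obtain ⟨h, rfl⟩ := actsOn_iff.mp hA
  obtain ⟨k, rfl⟩ := actsOn_iff.mp hB
  refine Matrix.ext fun x y => ?_
  rw [mul_apply_of_disjoint hST (embed_apply_eq_zero h) (embed_apply_eq_zero k),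
    mul_apply_of_disjoint hST.symm (embed_apply_eq_zero k) (embed_apply_eq_zero h),
    embed_apply_piecewise, embed_apply_piecewise, embed_apply, embed_apply,
    restrict_congr (S := T) (x := S.piecewise y x) (y := x)
      fun q hq => by simp [Finset.disjoint_right.mp hST hq],
    restrict_congr (S := S) (x := T.piecewise y x) (y := x)
      fun q hq => by simp [Finset.disjoint_left.mp hST hq]]
  have key : (∀ q, q ∉ T → S.piecewise y x q = y q) ↔ ∀ q, q ∉ S → T.piecewise y x q = y q := by
    refine forall_congr' fun q => ?_
    by_cases h1 : q ∈ S <;> by_cases h2 : q ∈ T <;> simp [h1, h2]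
  simp only [key]
  split_ifs
  · ring
  · simp

theorem embed_one (S : Finset Q) : embed S (1 : Op S) = 1 := by
  ext x y
  rw [embed_apply, Matrix.one_apply, Matrix.one_apply]
  by_cases hxy : x = y
  · simp [hxy]
  · rw [if_neg hxy]
    split_ifs with h1 h2
    · refine absurd (funext fun q => ?_) hxy
      by_cases hq : q ∈ S
      · exact congrFun h2 ⟨q, hq⟩
      · exact h1 q hq
    · rfl
    · rfl

theorem embed_mul (S : Finset Q) (h k : Op S) : embed S h * embed S k = embed S (h * k) := by
  ext x y
  rw [Matrix.mul_apply, embed_apply]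
  split_ifs with hxy
  · rw [Matrix.mul_apply]
    symm
    refine Fintype.sum_of_injective
      (fun (u : Bits S) (q : Q) => if hq : q ∈ S then u ⟨q, hq⟩ else x q) ?_ _ _ ?_ ?_
    · intro u w huw
      funext q
      simpa using congrFun huw q
    · intro w hw
      by_cases hxw : ∀ q, q ∉ S → x q = w q
      · refine absurd ⟨restrict w S, funext fun q => ?_⟩ hw
        by_cases hq : q ∈ S
        · simp [hq, restrict]
        · simp [hq, hxw q hq]
      · push Not at hxw
        rw [embed_apply_eq_zero h x w hxw, zero_mul]
    · intro u
      rw [embed_apply, embed_apply, if_pos fun q hq => by simp [hq],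
        if_pos fun q hq => by simp [hq, hxy q hq]]
      have : restrict (fun q => if hq : q ∈ S then u ⟨q, hq⟩ else x q) S = u :=
        funext fun q => by simp [restrict]
      rw [this]
  · refine Finset.sum_eq_zero fun w _ => ?_
    push Not at hxy
    obtain ⟨q, hq, hne⟩ := hxy
    by_cases hxw : x q = w q
    · rw [embed_apply_eq_zero k w y ⟨q, hq, hxw ▸ hne⟩, mul_zero]
    · rw [embed_apply_eq_zero h x w ⟨q, hq, hxw⟩, zero_mul]

theorem embed_conjTranspose (S : Finset Q) (h : Op S) : (embed S h)ᴴ = embed S hᴴ := by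
  ext x y
  rw [Matrix.conjTranspose_apply, embed_apply, embed_apply, Matrix.conjTranspose_apply]
  simp only [eq_comm (a := y _)]
  split_ifs <;> simp

theorem embed_mem_unitary {S : Finset Q} {h : Op S} (hh : h ∈ Matrix.unitaryGroup (Bits S) ℂ) :
    embed S h ∈ Matrix.unitaryGroup (Bits Q) ℂ := by
  rw [Matrix.mem_unitaryGroup_iff] at hh ⊢
  rw [Matrix.star_eq_conjTranspose] at hh ⊢
  rw [embed_conjTranspose, embed_mul, hh, embed_one]

/-- The operator commutes with all operators that act off `S`. -/
def SupportedOn (S : Finset Q) (A : Op Q) : Prop :=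
  ∀ (T : Finset Q) (B : Op Q), Disjoint S T → ActsOn T B → Commute A B

theorem ActsOn.supportedOn {S : Finset Q} {A : Op Q} (hA : ActsOn S A) : SupportedOn S A :=
  fun _ _ hST hB => hA.commute hB hST

theorem SupportedOn.mono {S S' : Finset Q} {A : Op Q} (hA : SupportedOn S A) (h : S ⊆ S') :
    SupportedOn S' A := fun T B hT hB => hA T B (hT.mono_left h) hB

theorem SupportedOn.mul {S : Finset Q} {A B : Op Q} (hA : SupportedOn S A)
    (hB : SupportedOn S B) : SupportedOn S (A * B) :=
  fun T D hT hD => (hA T D hT hD).mul_left (hB T D hT hD)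

/-- The tensor product of the gates `g e` on the pairwise disjoint regions `e ∈ P`. -/
noncomputable def layerOp (P : Finset (Finset Q)) (g : ∀ e : Finset Q, Op e) : Op Q :=
  Matrix.of fun x y => if ∀ q, (∀ e ∈ P, q ∉ e) → x q = y q
    then ∏ e ∈ P, g e (restrict x e) (restrict y e) else 0

theorem layerOp_apply (P : Finset (Finset Q)) (g : ∀ e : Finset Q, Op e) (x y : Bits Q) :
    layerOp P g x y = if ∀ q, (∀ e ∈ P, q ∉ e) → x q = y q
      then ∏ e ∈ P, g e (restrict x e) (restrict y e) else 0 := rfl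

theorem layerOp_empty (g : ∀ e : Finset Q, Op e) : layerOp ∅ g = 1 := by
  ext x y
  simp [layerOp_apply, Matrix.one_apply, funext_iff]

theorem layerOp_insert {P : Finset (Finset Q)} (g : ∀ e : Finset Q, Op e) {e : Finset Q}
    (he : e ∉ P) (hdis : ∀ f ∈ P, Disjoint e f) :
    layerOp (insert e P) g = embed e (g e) * layerOp P g := by
  have hT : Disjoint e (P.biUnion id) := by
    simpa [Finset.disjoint_biUnion_right] using hdis
  ext x y
  rw [mul_apply_of_disjoint hT (embed_apply_eq_zero _), embed_apply_piecewise, layerOp_apply,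
    layerOp_apply, Finset.prod_insert he]
  · have hp : ∏ f ∈ P, g f (restrict x f) (restrict y f) =
        ∏ f ∈ P, g f (restrict (e.piecewise y x) f) (restrict y f) :=
      Finset.prod_congr rfl fun f hf => by
        rw [restrict_congr (x := x) (y := e.piecewise y x)
          fun q hq => by simp [Finset.disjoint_right.mp (hdis f hf) hq]]
    have key : (∀ q, (∀ f ∈ insert e P, q ∉ f) → x q = y q) ↔
        ∀ q, (∀ f ∈ P, q ∉ f) → e.piecewise y x q = y q := by
      refine forall_congr' fun q => ?_
      by_cases h1 : q ∈ e <;> simp [h1]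
    simp only [key, hp]
    split_ifs <;> simp
  · rintro x y ⟨q, hq, hne⟩
    rw [layerOp_apply, if_neg]
    exact fun H => hne (H q fun f hf hqf => hq (Finset.mem_biUnion.mpr ⟨f, hf, hqf⟩))

theorem layerOp_mem_unitary {P : Finset (Finset Q)} {g : ∀ e : Finset Q, Op e}
    (hdis : ∀ e ∈ P, ∀ f ∈ P, e ≠ f → Disjoint e f)
    (hg : ∀ e ∈ P, g e ∈ Matrix.unitaryGroup (Bits e) ℂ) :
    layerOp P g ∈ Matrix.unitaryGroup (Bits Q) ℂ := by
  induction P using Finset.induction_on with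
  | empty => rw [layerOp_empty]; exact one_mem _
  | insert e P he ih =>
    simp only [Finset.forall_mem_insert] at hdis hg
    rw [layerOp_insert g he fun f hf => hdis.1.2 f hf (by rintro rfl; exact he hf)]
    exact mul_mem (embed_mem_unitary hg.1) (ih (fun e he => (hdis.2 e he).2) hg.2)

/-- The region to which conjugation with a layer of gates on `P` spreads the region `S`. -/
def spread (P : Finset (Finset Q)) (S : Finset Q) : Finset Q :=
  S ∪ (P.filter fun e => ¬ Disjoint e S).biUnion id

theorem mem_spread {P : Finset (Finset Q)} {S : Finset Q} {q : Q} :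
    q ∈ spread P S ↔ q ∈ S ∨ ∃ e ∈ P, q ∈ e ∧ ∃ p ∈ e, p ∈ S := by
  simp only [spread, Finset.mem_union, Finset.mem_biUnion, Finset.mem_filter, id,
    Finset.not_disjoint_iff]
  grind

/-- The gates are peeled off one at a time. A gate that misses `S` also misses the spread of `S`
under the other gates, because the gates are disjoint; so it commutes with the operator and cancels
against its adjoint. A gate that meets `S` is contained in the new region. Describing support by
commutation makes both cases pure algebra. -/
theorem SupportedOn.layer_conj {P : Finset (Finset Q)} {g : ∀ e : Finset Q, Op e}
    {S : Finset Q} {A : Op Q} (hA : SupportedOn S A)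
    (hdis : ∀ e ∈ P, ∀ f ∈ P, e ≠ f → Disjoint e f)
    (hg : ∀ e ∈ P, g e ∈ Matrix.unitaryGroup (Bits e) ℂ) :
    SupportedOn (spread P S) (layerOp P g * A * (layerOp P g)ᴴ) := by
  induction P using Finset.induction_on with
  | empty =>
    rw [layerOp_empty, one_mul, Matrix.conjTranspose_one, mul_one]
    exact hA.mono fun q hq => mem_spread.mpr (Or.inl hq)
  | insert e P he ih =>
    simp only [Finset.forall_mem_insert] at hdis hg
    have hd : ∀ f ∈ P, Disjoint e f := fun f hf => hdis.1.2 f hf (by rintro rfl; exact he hf)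
    have ih := ih (fun e he => (hdis.2 e he).2) hg.2
    have hsub : spread P S ⊆ spread (insert e P) S := fun q hq => by
      rw [mem_spread] at hq ⊢
      grind
    rw [layerOp_insert g he hd, Matrix.conjTranspose_mul]
    have hassoc : embed e (g e) * layerOp P g * A * ((layerOp P g)ᴴ * (embed e (g e))ᴴ) =
        embed e (g e) * (layerOp P g * A * (layerOp P g)ᴴ) * (embed e (g e))ᴴ := by
      simp only [mul_assoc]
    rw [hassoc]
    by_cases heS : Disjoint e S
    · have hcomm := ih e _ (by
        rw [Finset.disjoint_left]
        intro q hq hqe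
        rcases mem_spread.mp hq with h | ⟨f, hf, hqf, -⟩
        · exact Finset.disjoint_left.mp heS hqe h
        · exact Finset.disjoint_left.mp (hd f hf) hqe hqf) (actsOn_embed e (g e))
      have hu := Matrix.mem_unitaryGroup_iff.mp (embed_mem_unitary hg.1)
      rw [Matrix.star_eq_conjTranspose] at hu
      rw [← hcomm.eq, mul_assoc, hu, mul_one]
      exact ih.mono hsub
    · have hsub' : e ⊆ spread (insert e P) S := fun q hq => by
        obtain ⟨p, hp, hpS⟩ := Finset.not_disjoint_iff.mp heS
        exact mem_spread.mpr (Or.inr ⟨e, Finset.mem_insert_self _ _, hq, p, hp, hpS⟩)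
      have h1 : SupportedOn (spread (insert e P) S) (embed e (g e)) :=
        (actsOn_embed e (g e)).supportedOn.mono hsub'
      have h2 : SupportedOn (spread (insert e P) S) (embed e (g e))ᴴ := by
        rw [embed_conjTranspose]
        exact (actsOn_embed e _).supportedOn.mono hsub'
      exact (h1.mul (ih.mono hsub)).mul h2

/-- The qubits that a layer of gates on `P` couples to `q`. -/
def coupled (P : Finset (Finset Q)) (q : Q) : Finset Q :=
  Finset.univ.filter fun p => p = q ∨ ∃ e ∈ P, p ∈ e ∧ q ∈ e

theorem spread_eq_biUnion (P : Finset (Finset Q)) (S : Finset Q) :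
    spread P S = S.biUnion (coupled P) := by
  ext q
  simp only [mem_spread, coupled, Finset.mem_biUnion, Finset.mem_filter, Finset.mem_univ, true_and]
  grind

theorem card_coupled_le {P : Finset (Finset Q)} {k : ℕ} (hk : 1 ≤ k)
    (hcard : ∀ e ∈ P, e.card ≤ k)
    (hdis : ∀ e ∈ P, ∀ f ∈ P, e ≠ f → Disjoint e f) (q : Q) : (coupled P q).card ≤ k := by
  by_cases h : ∃ e ∈ P, q ∈ e
  · obtain ⟨e, he, hq⟩ := h
    refine (Finset.card_le_card fun p hp => ?_).trans (hcard e he)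
    rcases (Finset.mem_filter.mp hp).2 with rfl | ⟨f, hf, hpf, hqf⟩
    · exact hq
    · by_cases hef : e = f
      · exact hef ▸ hpf
      · exact absurd hqf (Finset.disjoint_left.mp (hdis e he f hf hef) hq)
  · refine (Finset.card_le_card (t := {q}) fun p hp => ?_).trans (by simpa using hk)
    rcases (Finset.mem_filter.mp hp).2 with rfl | ⟨f, hf, hpf, hqf⟩
    · simp
    · exact absurd ⟨f, hf, hqf⟩ h

theorem mem_coupled_comm {P : Finset (Finset Q)} {p q : Q} :
    p ∈ coupled P q ↔ q ∈ coupled P p := by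
  simp only [coupled, Finset.mem_filter, Finset.mem_univ, true_and]
  grind

/-- `W` is a unitary that spreads the qubit `i` to the region `L i`, where the regions have at most
`b` qubits and every qubit belongs to at most `b` of them. -/
structure HasLightCones (W : Op Q) (b : ℕ) (L : Q → Finset Q) : Prop where
  unitary : W ∈ Matrix.unitaryGroup (Bits Q) ℂ
  card_le : ∀ i, (L i).card ≤ b
  card_le' : ∀ j, (Finset.univ.filter fun i => j ∈ L i).card ≤ b
  conj : ∀ i A, ActsOn {i} A → SupportedOn (L i) (W * A * Wᴴ)

theorem hasLightCones_one : HasLightCones (1 : Op Q) 1 fun i => {i} where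
  unitary := one_mem _
  card_le := by simp
  card_le' j := by simp [Finset.filter_eq]
  conj i A hA := by simpa using hA.supportedOn

/-- Each qubit is coupled to at most `k` qubits, and coupling is symmetric, so both counts grow by
the factor `k`. The value `k = 2` serves the layers of a circuit, `k = 1` a layer of one-qubit
gates. -/
theorem HasLightCones.layer_mul {W : Op Q} {b k : ℕ} {L : Q → Finset Q}
    (hW : HasLightCones W b L) {P : Finset (Finset Q)} {g : ∀ e : Finset Q, Op e} (hk : 1 ≤ k)
    (hcard : ∀ e ∈ P, e.card ≤ k)
    (hdis : ∀ e ∈ P, ∀ f ∈ P, e ≠ f → Disjoint e f)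
    (hg : ∀ e ∈ P, g e ∈ Matrix.unitaryGroup (Bits e) ℂ) :
    HasLightCones (layerOp P g * W) (k * b) fun i => spread P (L i) where
  unitary := mul_mem (layerOp_mem_unitary hdis hg) hW.unitary
  card_le i := by
    rw [spread_eq_biUnion, mul_comm]
    exact (Finset.card_biUnion_le_card_mul _ _ _ fun q _ => card_coupled_le hk hcard hdis q).trans
      (Nat.mul_le_mul_right _ (hW.card_le i))
  card_le' j := by
    have hsub : (Finset.univ.filter fun i => j ∈ spread P (L i)) ⊆
        (coupled P j).biUnion fun p => Finset.univ.filter fun i => p ∈ L i := by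
      intro i hi
      simp only [spread_eq_biUnion, Finset.mem_filter, Finset.mem_univ, true_and,
        Finset.mem_biUnion] at hi ⊢
      obtain ⟨p, hp, hj⟩ := hi
      exact ⟨p, mem_coupled_comm.mp hj, hp⟩
    exact (Finset.card_le_card hsub).trans
      ((Finset.card_biUnion_le_card_mul _ _ _ fun p _ => hW.card_le' p).trans
        (Nat.mul_le_mul_right _ (card_coupled_le hk hcard hdis j)))
  conj i A hA := by
    have := (hW.conj i A hA).layer_conj hdis hg
    rw [Matrix.conjTranspose_mul]
    simpa only [mul_assoc] using this

theorem IsCircuit.exists_hasLightCones {d : ℕ} {U : Op Q} (hU : IsCircuit d U) :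
    ∃ L, HasLightCones U (2 ^ d) L := by
  obtain ⟨l, rfl, hl, rfl⟩ := hU
  induction l with
  | nil => exact ⟨_, hasLightCones_one⟩
  | cons A l ih =>
    obtain ⟨L, hL⟩ := ih fun B hB => hl B (List.mem_cons_of_mem _ hB)
    obtain ⟨P, g, hcard, hdis, hg, hA⟩ := hl A List.mem_cons_self
    have hA : A = layerOp P g := Matrix.ext hA
    rw [List.prod_cons, hA, List.length_cons, pow_succ']
    exact ⟨_, hL.layer_mul one_le_two (fun e he => (hcard e he).le) hdis hg⟩

end LightCone

end QCode

namespace QCode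

/-! ### Concentration of the output distribution of a shallow circuit. -/

section Isoperimetry

theorem conjTranspose_mul_self_diag {m : Type*} [Fintype m] (N : Matrix m m ℂ) (j : m) :
    (Nᴴ * N) j j = ((∑ s, ‖N s j‖ ^ 2 : ℝ) : ℂ) := by
  rw [Matrix.mul_apply, Complex.ofReal_sum]
  refine Finset.sum_congr rfl fun s _ => ?_
  rw [Matrix.conjTranspose_apply, Complex.ofReal_pow, ← Complex.conj_mul']
  rfl

theorem sum_norm_sq_unitary_mul {m : Type*} [Fintype m] [DecidableEq m] {M : Matrix m m ℂ}
    (hM : M ∈ Matrix.unitaryGroup m ℂ) (N : Matrix m m ℂ) (j : m) :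
    ∑ s, ‖(M * N) s j‖ ^ 2 = ∑ s, ‖N s j‖ ^ 2 := by
  have h := Matrix.mem_unitaryGroup_iff'.mp hM
  rw [Matrix.star_eq_conjTranspose] at h
  have : (M * N)ᴴ * (M * N) = Nᴴ * N := by
    rw [Matrix.conjTranspose_mul, mul_assoc, ← mul_assoc Mᴴ, h, one_mul]
  have h2 := conjTranspose_mul_self_diag (M * N) j
  rw [this, conjTranspose_mul_self_diag] at h2
  exact_mod_cast h2.symm

theorem sum_norm_sq_unitary {m : Type*} [Fintype m] [DecidableEq m] {M : Matrix m m ℂ}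
    (hM : M ∈ Matrix.unitaryGroup m ℂ) (j : m) : ∑ s, ‖M s j‖ ^ 2 = 1 := by
  have := sum_norm_sq_unitary_mul hM 1 j
  rw [mul_one] at this
  rw [this, Finset.sum_eq_single j] <;> simp +contextual

variable {Q : Type} [Fintype Q] [DecidableEq Q]

theorem actsOn_diagonal {S : Finset Q} {g : Bits Q → ℂ}
    (hg : ∀ x y, (∀ q ∈ S, x q = y q) → g x = g y) : ActsOn S (Matrix.diagonal g) := by
  refine ⟨Matrix.diagonal fun u => g fun q => if h : q ∈ S then u ⟨q, h⟩ else 0, fun x y => ?_⟩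
  by_cases hxy : x = y
  · subst hxy
    simp only [Matrix.diagonal_apply_eq, implies_true, if_true]
    exact hg _ _ fun q hq => by simp [hq, restrict]
  · rw [Matrix.diagonal_apply_ne _ hxy]
    split_ifs with h
    · rw [Matrix.diagonal_apply_ne]
      intro H
      refine hxy (funext fun q => ?_)
      by_cases hq : q ∈ S
      · exact congrFun H ⟨q, hq⟩
      · exact h q hq
    · rfl

/-- Erasing the bits in `L i` turns `f` into an observable `G` that commutes with every evolved
operator on qubit `i`. Pulled back to the input, `G` therefore cannot excite qubit `i` from the zero
state, and only `F - G` contributes. By the Lipschitz condition its entries are at most the number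
of output bits in `L i`. -/
theorem HasLightCones.sum_excited_le {W : Op Q} {b : ℕ} {L : Q → Finset Q}
    (hW : HasLightCones W b L) {out : Finset Q} {f : Bits Q → ℝ}
    (hf : ∀ x y, |f x - f y| ≤ ((out.filter fun q => x q ≠ y q).card : ℝ)) (i : Q) :
    ∑ s with s i ≠ 0, ‖(Wᴴ * (Matrix.diagonal fun x => (f x : ℂ)) * W) s 0‖ ^ 2
      ≤ ((out ∩ L i).card : ℝ) ^ 2 := by
  set F : Op Q := Matrix.diagonal fun x => (f x : ℂ) with hF
  set G : Op Q := Matrix.diagonal fun x => (f ((L i).piecewise 0 x) : ℂ) with hG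
  set K : Op Q := Matrix.diagonal fun x => if x i = 0 then 0 else 1 with hK
  have hu := Matrix.mem_unitaryGroup_iff'.mp hW.unitary
  rw [Matrix.star_eq_conjTranspose] at hu
  have hcomm : Commute (W * K * Wᴴ) G := by
    refine hW.conj i K (actsOn_diagonal fun x y h => by simp [h i (by simp)]) (L i)ᶜ G
      disjoint_compl_right (actsOn_diagonal fun x y h => ?_)
    congr 2
    funext q
    by_cases hq : q ∈ L i
    · simp [hq]
    · simp [hq, h q (by simpa using hq)]
  have hKG : K * (Wᴴ * G * W) = Wᴴ * G * W * K := by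
    calc K * (Wᴴ * G * W) = Wᴴ * W * K * (Wᴴ * G * W) := by rw [hu, one_mul]
      _ = Wᴴ * ((W * K * Wᴴ) * G) * W := by simp only [mul_assoc]
      _ = Wᴴ * G * W * K * (Wᴴ * W) := by rw [hcomm.eq]; simp only [mul_assoc]
      _ = Wᴴ * G * W * K := by rw [hu, mul_one]
  -- `K` projects onto the strings with bit `i` set and annihilates the zero state.
  have hzero : ∀ s : Bits Q, s i ≠ 0 → (Wᴴ * G * W) s 0 = 0 := fun s hs => by
    have := congrFun (congrFun hKG s) 0
    rw [hK, Matrix.diagonal_mul, Matrix.mul_diagonal] at this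
    simpa [hs] using this
  have hsub : ∀ s : Bits Q, s i ≠ 0 → (Wᴴ * F * W) s 0 = (Wᴴ * ((F - G) * W)) s 0 :=
    fun s hs => by
      rw [sub_mul, mul_sub, Matrix.sub_apply, ← mul_assoc, ← mul_assoc, hzero s hs, sub_zero]
  have hWu : Wᴴ ∈ Matrix.unitaryGroup (Bits Q) ℂ := by
    rw [← Matrix.star_eq_conjTranspose]
    exact Unitary.star_mem hW.unitary
  calc ∑ s with s i ≠ 0, ‖(Wᴴ * F * W) s 0‖ ^ 2
      = ∑ s with s i ≠ 0, ‖(Wᴴ * ((F - G) * W)) s 0‖ ^ 2 :=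
        Finset.sum_congr rfl fun s hs => by rw [hsub s (Finset.mem_filter.mp hs).2]
    _ ≤ ∑ s, ‖(Wᴴ * ((F - G) * W)) s 0‖ ^ 2 :=
        Finset.sum_le_sum_of_subset_of_nonneg (Finset.filter_subset _ _) fun _ _ _ => by positivity
    _ = ∑ x, ‖((F - G) * W) x 0‖ ^ 2 := sum_norm_sq_unitary_mul hWu _ _
    _ ≤ ∑ x, ((out ∩ L i).card : ℝ) ^ 2 * ‖W x 0‖ ^ 2 := by
        refine Finset.sum_le_sum fun x _ => ?_
        rw [hF, hG, Matrix.diagonal_sub, Matrix.diagonal_mul, norm_mul, mul_pow,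
          ← Complex.ofReal_sub, Complex.norm_real, Real.norm_eq_abs]
        gcongr
        refine (hf _ _).trans ?_
        exact_mod_cast Finset.card_le_card fun q hq => by
          obtain ⟨h1, h2⟩ := Finset.mem_filter.mp hq
          refine Finset.mem_inter.mpr ⟨h1, ?_⟩
          by_contra h
          exact h2 (by simp [h])
    _ = ((out ∩ L i).card : ℝ) ^ 2 := by
        rw [← Finset.mul_sum, sum_norm_sq_unitary hW.unitary, mul_one]

/-- Observables that change by at most one with each output bit have small variance in the states
prepared by circuits with small light cones. -/
theorem HasLightCones.variance_le {W : Op Q} {b : ℕ} {L : Q → Finset Q}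
    (hW : HasLightCones W b L) {out : Finset Q} {f : Bits Q → ℝ}
    (hf : ∀ x y, |f x - f y| ≤ ((out.filter fun q => x q ≠ y q).card : ℝ)) :
    ∑ x, ‖W x 0‖ ^ 2 * f x ^ 2 - (∑ x, ‖W x 0‖ ^ 2 * f x) ^ 2 ≤ out.card * (b : ℝ) ^ 2 := by
  set F : Op Q := Matrix.diagonal fun x => (f x : ℂ) with hF
  have hWu : Wᴴ ∈ Matrix.unitaryGroup (Bits Q) ℂ := by
    rw [← Matrix.star_eq_conjTranspose]
    exact Unitary.star_mem hW.unitary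
  set u : Bits Q → ℂ := fun s => (Wᴴ * F * W) s 0 with hu
  have h1 : ∑ x, ‖W x 0‖ ^ 2 * f x ^ 2 = ∑ s, ‖u s‖ ^ 2 := by
    simp only [hu, mul_assoc]
    rw [sum_norm_sq_unitary_mul hWu]
    refine Finset.sum_congr rfl fun x _ => ?_
    rw [hF, Matrix.diagonal_mul, norm_mul, mul_pow, Complex.norm_real, Real.norm_eq_abs, sq_abs,
      mul_comm]
  have h2 : u 0 = ((∑ x, ‖W x 0‖ ^ 2 * f x : ℝ) : ℂ) := by
    simp only [hu, mul_assoc]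
    rw [Matrix.mul_apply, Complex.ofReal_sum]
    refine Finset.sum_congr rfl fun x _ => ?_
    rw [hF, Matrix.diagonal_mul, Matrix.conjTranspose_apply, Complex.ofReal_mul,
      Complex.ofReal_pow, ← Complex.conj_mul', starRingEnd_apply]
    ring
  have h3 : (∑ x, ‖W x 0‖ ^ 2 * f x) ^ 2 = ‖u 0‖ ^ 2 := by
    rw [h2, Complex.norm_real, Real.norm_eq_abs, sq_abs]
  -- The variance is the weight of `u` off the zero string, and every nonzero string is counted by
  -- at least one excited qubit.
  have h4 : ∑ s, ‖u s‖ ^ 2 - ‖u 0‖ ^ 2 ≤ ∑ i, ∑ s with s i ≠ 0, ‖u s‖ ^ 2 := by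
    simp only [Finset.sum_filter]
    rw [Finset.sum_comm, ← Finset.add_sum_erase _ _ (Finset.mem_univ (0 : Bits Q)),
      add_sub_cancel_left]
    calc ∑ s ∈ Finset.univ.erase 0, ‖u s‖ ^ 2
        ≤ ∑ s ∈ Finset.univ.erase 0, ∑ i, if s i ≠ 0 then ‖u s‖ ^ 2 else 0 := by
          refine Finset.sum_le_sum fun s hs => ?_
          obtain ⟨i, hi⟩ := Function.ne_iff.mp (Finset.ne_of_mem_erase hs)
          have := Finset.single_le_sum (f := fun i => if s i ≠ 0 then ‖u s‖ ^ 2 else 0)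
            (fun j _ => by split_ifs <;> positivity) (Finset.mem_univ i)
          simpa [show s i ≠ 0 from hi] using this
      _ ≤ _ := Finset.sum_le_sum_of_subset_of_nonneg (Finset.erase_subset _ _) fun s _ _ =>
          Finset.sum_nonneg fun i _ => by split_ifs <;> positivity
  -- One factor is bounded by the size of a light cone; the other is summed by double counting, each
  -- output bit lying in at most `b` cones.
  have h5 : ∑ i, ((out ∩ L i).card : ℝ) ^ 2 ≤ out.card * (b : ℝ) ^ 2 := by
    have hb : ∀ i, ((out ∩ L i).card : ℝ) ≤ b := fun i => by
      exact_mod_cast (Finset.card_le_card Finset.inter_subset_right).trans (hW.card_le i)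
    have hN : ∑ i, (out ∩ L i).card ≤ out.card * b := by
      have h6 : ∀ i, (out ∩ L i).card = ∑ j ∈ out, if j ∈ L i then 1 else 0 := fun i => by
        rw [← Finset.filter_mem_eq_inter, Finset.card_filter]
      simp only [h6]
      rw [Finset.sum_comm, ← smul_eq_mul]
      refine Finset.sum_le_card_nsmul _ _ _ fun j _ => ?_
      rw [← Finset.card_filter]
      exact hW.card_le' j
    calc ∑ i, ((out ∩ L i).card : ℝ) ^ 2 ≤ ∑ i, (b : ℝ) * ((out ∩ L i).card : ℝ) :=
          Finset.sum_le_sum fun i _ => by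
            rw [sq]
            exact mul_le_mul_of_nonneg_right (hb i) (by positivity)
      _ = b * ((∑ i, (out ∩ L i).card : ℕ) : ℝ) := by rw [← Finset.mul_sum]; push_cast; rfl
      _ ≤ b * ((out.card * b : ℕ) : ℝ) := by gcongr
      _ = out.card * (b : ℝ) ^ 2 := by push_cast; ring
  rw [h1, h3]
  exact h4.trans ((Finset.sum_le_sum fun i _ => hW.sum_excited_le hf i).trans h5)

/-- A function that separates two sets by `D` has variance at least half the product of their
masses times `D ^ 2`. -/
theorem mass_mul_mass_le_variance {X : Type*} [Fintype X] {p f : X → ℝ} (hp : ∀ x, 0 ≤ p x)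
    (hp1 : ∑ x, p x = 1) (S T : Finset X) {D : ℝ} (hD : 0 ≤ D)
    (hS : ∀ x ∈ S, f x = 0) (hT : ∀ x ∈ T, D ≤ f x) :
    (∑ x ∈ S, p x) * (∑ x ∈ T, p x) * D ^ 2 ≤
      2 * (∑ x, p x * f x ^ 2 - (∑ x, p x * f x) ^ 2) := by
  -- Twice the variance is the mean square difference of two independent samples; only the pairs in
  -- `S × T` are kept.
  have h1 : ∑ x, ∑ y, p x * p y * (f x - f y) ^ 2 =
      2 * (∑ x, p x * f x ^ 2 - (∑ x, p x * f x) ^ 2) := by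
    have h2 : ∀ x y, p x * p y * (f x - f y) ^ 2 =
        p x * f x ^ 2 * p y + p x * (p y * f y ^ 2) - 2 * (p x * f x * (p y * f y)) :=
      fun x y => by ring
    simp only [h2, Finset.sum_sub_distrib, Finset.sum_add_distrib, ← Finset.mul_sum,
      ← Finset.sum_mul, hp1]
    ring
  rw [← h1, Finset.sum_mul_sum, Finset.sum_mul]
  have hnn : ∀ x y, 0 ≤ p x * p y * (f x - f y) ^ 2 := fun x y =>
    mul_nonneg (mul_nonneg (hp x) (hp y)) (sq_nonneg _)
  refine le_trans (Finset.sum_le_sum fun x hx => ?_)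
    (Finset.sum_le_sum_of_subset_of_nonneg (Finset.subset_univ S)
      fun x _ _ => Finset.sum_nonneg fun y _ => hnn x y)
  rw [Finset.sum_mul]
  refine le_trans (Finset.sum_le_sum fun y hy => ?_)
    (Finset.sum_le_sum_of_subset_of_nonneg (Finset.subset_univ T) fun y _ _ => hnn x y)
  rw [hS x hx, zero_sub, neg_sq]
  exact mul_le_mul_of_nonneg_left (pow_le_pow_left₀ hD (hT y hy) 2) (mul_nonneg (hp x) (hp y))

/-- The probability of the outcome `y` on the first register. -/
noncomputable def outcomeProb {N R : Type} [Fintype R] [DecidableEq N] [DecidableEq R]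
    (W : Op (N ⊕ R)) (y : Bits N) : ℝ := ∑ w : Bits R, ‖W (Sum.elim y w) 0‖ ^ 2

theorem sum_bits_sum {N R : Type} [Fintype N] [DecidableEq N] [Fintype R] [DecidableEq R]
    {M : Type*} [AddCommMonoid M] (F : Bits (N ⊕ R) → M) : ∑ x, F x = ∑ y : Bits N, ∑ w : Bits R, F (Sum.elim y w) := by
  rw [← Fintype.sum_prod_type']
  exact Fintype.sum_equiv (Equiv.sumArrowEquivProdArrow N R (ZMod 2)) _ _ fun x => by
    simp [Equiv.sumArrowEquivProdArrow]

/-- The outcome distribution of a circuit with small light cones does not put much mass on both of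
two sets that are far from each other. -/
theorem HasLightCones.mass_mul_mass_le {N R : Type} [Fintype N] [DecidableEq N] [Fintype R]
    [DecidableEq R] {W : Op (N ⊕ R)} {b : ℕ} {L : N ⊕ R → Finset (N ⊕ R)}
    (hW : HasLightCones W b L) (S T : Finset (Bits N)) (D : ℕ)
    (hST : ∀ x ∈ S, ∀ y ∈ T, D ≤ hammingDist y x) :
    (∑ y ∈ S, outcomeProb W y) * (∑ y ∈ T, outcomeProb W y) * (D : ℝ) ^ 2 ≤
      2 * (Fintype.card N * (b : ℝ) ^ 2) := by
  rcases S.eq_empty_or_nonempty with rfl | hne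
  · simp only [Finset.sum_empty, zero_mul]
    positivity
  -- The Hamming distance to `S` is 1-Lipschitz, zero on `S` and at least `D` on `T`.
  set f : Bits N → ℝ := fun y => ((S.inf' hne fun s => hammingDist y s : ℕ) : ℝ) with hf
  have hlip : ∀ x y, f x ≤ f y + hammingDist x y := fun x y => by
    obtain ⟨s, hs, hsy⟩ := S.exists_mem_eq_inf' hne fun s => hammingDist y s
    have h1 : S.inf' hne (fun s => hammingDist x s) ≤ hammingDist x s := Finset.inf'_le _ hs
    have h2 := hammingDist_triangle x y s
    have h3 : S.inf' hne (fun s => hammingDist x s) ≤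
        S.inf' hne (fun s => hammingDist y s) + hammingDist x y := by omega
    simp only [hf]
    exact_mod_cast h3
  have hvar := hW.variance_le (out := Finset.univ.map Function.Embedding.inl)
    (f := fun x => f (x ∘ Sum.inl)) fun x y => by
      have hc : ((Finset.univ.map (Function.Embedding.inl : N ↪ N ⊕ R)).filter
          fun q => x q ≠ y q).card = hammingDist (x ∘ Sum.inl) (y ∘ Sum.inl) := by
        rw [Finset.filter_map, Finset.card_map]
        rfl
      rw [hc, abs_le]
      have h1 := hlip (x ∘ Sum.inl) (y ∘ Sum.inl)
      have h2 := hlip (y ∘ Sum.inl) (x ∘ Sum.inl)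
      rw [hammingDist_comm] at h2
      constructor <;> linarith
  simp only [sum_bits_sum (N := N) (R := R), Sum.elim_comp_inl, ← Finset.sum_mul] at hvar
  rw [Finset.card_map, Finset.card_univ] at hvar
  have hp1 : ∑ y, outcomeProb W y = 1 := by
    have := sum_norm_sq_unitary hW.unitary 0
    rwa [sum_bits_sum] at this
  refine (mass_mul_mass_le_variance (p := outcomeProb W) (f := f)
    (fun y => Finset.sum_nonneg fun _ _ => by positivity) hp1 S T (Nat.cast_nonneg D)
    (fun x hx => ?_) fun y hy => ?_).trans (mul_le_mul_of_nonneg_left hvar zero_le_two)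
  · have : S.inf' hne (fun s => hammingDist x s) ≤ hammingDist x x := Finset.inf'_le _ hx
    rw [hammingDist_self, Nat.le_zero] at this
    simp only [hf, this, Nat.cast_zero]
  · simp only [hf]
    exact_mod_cast Finset.le_inf' hne _ fun x hx => hST x hx y hy

end Isoperimetry

end QCode

namespace QCode

/-! ### Expectation values and the uncertainty relation. -/

section Operators

variable {Q : Type} [Fintype Q] [DecidableEq Q]

theorem apply_coord (A : Op Q) (ψ : Vec Q) (x : Bits Q) : apply A ψ x = ∑ y, A x y * ψ y := rfl

theorem apply_mul (A B : Op Q) (ψ : Vec Q) : apply (A * B) ψ = apply A (apply B ψ) := by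
  simp [apply]

theorem apply_one (ψ : Vec Q) : apply (1 : Op Q) ψ = ψ := by
  simp [apply]

theorem apply_add (A B : Op Q) (ψ : Vec Q) : apply (A + B) ψ = apply A ψ + apply B ψ := by
  simp [apply]

theorem apply_vec_add (A : Op Q) (ψ φ : Vec Q) : apply A (ψ + φ) = apply A ψ + apply A φ :=
  map_add _ _ _

theorem apply_vec_smul (A : Op Q) (c : ℂ) (ψ : Vec Q) : apply A (c • ψ) = c • apply A ψ :=
  map_smul _ _ _

theorem apply_zero (A : Op Q) : apply A (0 : Vec Q) = 0 := map_zero _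

theorem apply_diagonal_coord (d : Bits Q → ℂ) (ψ : Vec Q) (x : Bits Q) :
    apply (Matrix.diagonal d) ψ x = d x * ψ x := by
  rw [apply_coord, Finset.sum_eq_single x] <;> simp +contextual [Matrix.diagonal_apply]
  intro b hb h
  exact absurd h.symm hb

theorem inner_apply_left (A : Op Q) (ψ φ : Vec Q) :
    inner ℂ (apply A ψ) φ = inner ℂ ψ (apply Aᴴ φ) := by
  have h : Matrix.toEuclideanCLM (n := Bits Q) (𝕜 := ℂ) Aᴴ =
      ContinuousLinearMap.adjoint (Matrix.toEuclideanCLM (n := Bits Q) (𝕜 := ℂ) A) := by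
    rw [← ContinuousLinearMap.star_eq_adjoint, ← map_star]
    rfl
  rw [apply, apply, h, ContinuousLinearMap.adjoint_inner_right]

/-- The expectation value of `M` in the (not necessarily normalized) vector `v`. -/
noncomputable def expect (M : Op Q) (v : Vec Q) : ℝ := (inner ℂ v (apply M v)).re

theorem expect_add (M N : Op Q) (v : Vec Q) : expect (M + N) v = expect M v + expect N v := by
  rw [expect, apply_add, inner_add_right, Complex.add_re]; rfl

theorem apply_real_smul (c : ℝ) (A : Op Q) (ψ : Vec Q) :
    apply (c • A) ψ = (c : ℂ) • apply A ψ := by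
  ext x
  simp [apply_coord, Finset.mul_sum, mul_assoc]

theorem expect_smul (c : ℝ) (M : Op Q) (v : Vec Q) : expect (c • M) v = c * expect M v := by
  rw [expect, expect, apply_real_smul, inner_smul_right, Complex.re_ofReal_mul]

theorem expect_neg (M : Op Q) (v : Vec Q) : expect (-M) v = -expect M v := by
  simpa using expect_smul (-1) M v

theorem expect_sub (M N : Op Q) (v : Vec Q) : expect (M - N) v = expect M v - expect N v := by
  rw [sub_eq_add_neg, expect_add, expect_neg, sub_eq_add_neg]

theorem expect_zero (v : Vec Q) : expect (0 : Op Q) v = 0 := by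
  simpa using expect_smul 0 (0 : Op Q) v

theorem expect_sum {ι : Type*} (s : Finset ι) (M : ι → Op Q) (v : Vec Q) :
    expect (∑ i ∈ s, M i) v = ∑ i ∈ s, expect (M i) v := by
  classical
  induction s using Finset.induction_on with
  | empty => simp [expect_zero]
  | insert i s hi ih => rw [Finset.sum_insert hi, Finset.sum_insert hi, expect_add, ih]

theorem expect_eq_dotProduct (M : Op Q) (v : Vec Q) :
    expect M v = (star (v : Bits Q → ℂ) ⬝ᵥ M *ᵥ (v : Bits Q → ℂ)).re := by
  rw [expect, EuclideanSpace.inner_eq_star_dotProduct, dotProduct_comm]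
  rfl

theorem expect_nonneg {M : Op Q} (hM : M.PosSemidef) (v : Vec Q) : 0 ≤ expect M v := by
  rw [expect_eq_dotProduct]
  exact (Complex.nonneg_iff.mp (hM.dotProduct_mulVec_nonneg _)).1

theorem expect_diagonal (d : Bits Q → ℝ) (v : Vec Q) :
    expect (Matrix.diagonal fun x => (d x : ℂ)) v = ∑ x, d x * ‖v x‖ ^ 2 := by
  rw [expect, PiLp.inner_apply, Complex.re_sum]
  refine Finset.sum_congr rfl fun x _ => ?_
  rw [apply_diagonal_coord, ← smul_eq_mul, inner_smul_right, inner_self_eq_norm_sq_to_K,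
    Complex.re_ofReal_mul]
  norm_cast

theorem norm_apply_of_involution {A : Op Q} (hA : Aᴴ = A) (hAA : A * A = 1) (v : Vec Q) :
    ‖apply A v‖ = ‖v‖ := by
  have h : inner ℂ (apply A v) (apply A v) = inner ℂ v v := by
    rw [inner_apply_left, hA, ← apply_mul, hAA, apply_one]
  rw [inner_self_eq_norm_sq_to_K, inner_self_eq_norm_sq_to_K] at h
  have h' : ‖apply A v‖ ^ 2 = ‖v‖ ^ 2 := by exact_mod_cast h
  exact (pow_left_inj₀ (norm_nonneg _) (norm_nonneg _) two_ne_zero).mp h'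

theorem re_inner_comm (v w : Vec Q) : (inner ℂ v w).re = (inner ℂ w v).re := by
  rw [← inner_conj_symm, Complex.conj_re]

theorem expect_involution_le {A : Op Q} (hA : Aᴴ = A) (hAA : A * A = 1) (v : Vec Q) :
    expect A v ≤ ‖v‖ ^ 2 := by
  have h := re_inner_le_norm (𝕜 := ℂ) v (apply A v)
  rw [norm_apply_of_involution hA hAA, ← sq] at h
  exact h

/-- An uncertainty relation: two `±1`-valued observables that anticommute on a common invariant
subspace cannot both be almost certain in states that are close to that subspace. -/
theorem expect_add_le_of_anticommute {A B : Op Q} (hA : Aᴴ = A) (hAA : A * A = 1) (hB : Bᴴ = B)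
    (hBB : B * B = 1) {K : Submodule ℂ (Vec Q)} (hAK : ∀ φ ∈ K, apply A φ ∈ K)
    (hBK : ∀ φ ∈ K, apply B φ ∈ K)
    (hAB : ∀ φ ∈ K, apply A (apply B φ) = - apply B (apply A φ)) (v : Vec Q) :
    expect A v + expect B v ≤
      3 / 2 * ‖K.starProjection v‖ ^ 2 + 2 * ‖v - K.starProjection v‖ ^ 2 := by
  set φ := K.starProjection v with hφ
  have hφK : φ ∈ K := K.starProjection_apply_mem v
  have horth : ∀ w ∈ K, inner ℂ w (v - φ) = 0 :=
    K.mem_orthogonal _ |>.mp (K.sub_starProjection_mem_orthogonal v)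
  generalize hr : v - φ = r at *
  have hv : v = φ + r := by rw [← hr]; abel
  -- A Hermitian operator that preserves `K` has no cross terms between `K` and its orthogonal
  -- complement.
  have split : ∀ M : Op Q, Mᴴ = M → (∀ φ ∈ K, apply M φ ∈ K) →
      expect M v = expect M φ + expect M r := fun M hM hMK => by
    have h1 : inner ℂ φ (apply M r) = 0 := by
      rw [← hM, ← inner_apply_left]
      exact horth _ (hMK φ hφK)
    have h2 : inner ℂ r (apply M φ) = 0 := by
      rw [← inner_conj_symm, horth _ (hMK φ hφK), map_zero]
    simp [expect, hv, apply_vec_add, h1, h2]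
  have hcross : (inner ℂ (apply A φ) (apply B φ)).re = 0 := by
    have h1 : (inner ℂ (apply A φ) (apply B φ)).re = (inner ℂ φ (apply A (apply B φ))).re := by
      rw [inner_apply_left, hA]
    have h2 : (inner ℂ (apply B φ) (apply A φ)).re = (inner ℂ φ (apply B (apply A φ))).re := by
      rw [inner_apply_left, hB]
    rw [hAB φ hφK, inner_neg_right, Complex.neg_re, ← h2,
      re_inner_comm (apply B φ) (apply A φ)] at h1
    linarith
  -- Anticommutation makes `A φ` and `B φ` orthogonal in real part, so expanding the square gives `0
  -- ≤ 3 ‖φ‖ ^ 2 - 2 (expect A φ + expect B φ)`. The constant `3 / 2` is not optimal, but anything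
  -- below `2` suffices.
  have hφ2 : expect A φ + expect B φ ≤ 3 / 2 * ‖φ‖ ^ 2 := by
    have h0 := sq_nonneg ‖apply A φ + apply B φ - φ‖
    rw [norm_sub_sq (𝕜 := ℂ), norm_add_sq (𝕜 := ℂ), norm_apply_of_involution hA hAA,
      norm_apply_of_involution hB hBB] at h0
    simp only [RCLike.re_to_complex, inner_add_left, Complex.add_re, hcross] at h0
    rw [re_inner_comm (apply A φ) φ, re_inner_comm (apply B φ) φ] at h0
    simp only [expect]
    linarith
  rw [split A hA hAK, split B hB hBK]
  linarith [expect_involution_le hA hAA r, expect_involution_le hB hBB r]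

end Operators

/-! ### Fattenings and the distance operator. -/

section Distance

variable {Q : Type} [Fintype Q] [DecidableEq Q]

theorem expect_projMatrix (V : Submodule ℂ (Vec Q)) (v : Vec Q) :
    expect (projMatrix V) v = ‖V.starProjection v‖ ^ 2 := by
  have h : apply (projMatrix V) v = V.starProjection v := by
    simp [apply, projMatrix]
  rw [expect, h]
  have := V.inner_starProjection_left_eq_right v (V.starProjection v)
  rw [V.starProjection_eq_self_iff.mpr (V.starProjection_apply_mem v)] at this
  rw [← this, inner_self_eq_norm_sq_to_K]
  norm_cast

theorem fattening_mono (V : Submodule ℂ (Vec Q)) : Monotone (fattening V) := fun _ _ hst =>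
  Submodule.span_mono fun _ ⟨A, ψ, hψ, hA, hφ⟩ => ⟨A, ψ, hψ, hA.trans hst, hφ⟩

/-- If `ψ y ≠ 0`, the product operator with factors `|x i⟩⟨y i|` sends `ψ` to a nonzero multiple of
the basis vector `x`. -/
theorem fattening_card_eq_top {V : Submodule ℂ (Vec Q)} (hV : V ≠ ⊥) :
    fattening V (Fintype.card Q) = ⊤ := by
  obtain ⟨ψ, hψ, hne⟩ := V.ne_bot_iff.mp hV
  obtain ⟨y, hy⟩ : ∃ y, ψ y ≠ 0 := by
    by_contra! h
    exact hne (by ext y; simpa using h y)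
  have hbasis : ∀ x : Bits Q, EuclideanSpace.single x (1 : ℂ) ∈ fattening V (Fintype.card Q) := by
    intro x
    have hmem : apply (tensor fun i => Matrix.single (x i) (y i) 1) ψ ∈
        fattening V (Fintype.card Q) := by
      refine Submodule.subset_span ⟨_, ψ, hψ, ?_, rfl⟩
      rw [← Nat.card_eq_fintype_card]
      exact Set.ncard_le_card _
    have heq : apply (tensor fun i => Matrix.single (x i) (y i) 1) ψ =
        ψ y • EuclideanSpace.single x (1 : ℂ) := by
      ext w
      have hprod : ∀ u : Bits Q, (∏ i, Matrix.single (x i) (y i) (1 : ℂ) (w i) (u i)) =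
          if x = w ∧ y = u then 1 else 0 := fun u => by
        simp only [Matrix.single_apply, Finset.prod_ite_zero, Finset.prod_const_one, funext_iff,
          Finset.mem_univ, true_implies, forall_and]
      simp only [apply_coord, tensor, Matrix.of_apply, hprod]
      by_cases hw : x = w
      · simp [hw]
      · simp [hw, Ne.symm hw]
    rw [heq] at hmem
    exact (Submodule.smul_mem_iff _ hy).mp hmem
  rw [eq_top_iff]
  intro v _
  rw [← (EuclideanSpace.basisFun (Bits Q) ℂ).sum_repr v]
  exact Submodule.sum_mem _ fun x _ => Submodule.smul_mem _ _ (by simpa using hbasis x)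

/-- The increments beyond `t` have weight at least `t + 1` and telescope; the earlier ones are
nonnegative. For `n < t` the left side is not positive. -/
theorem le_sum_mul_sub {a : ℕ → ℝ} (ha : Monotone a) (t n : ℕ) :
    (t + 1 : ℝ) * (a n - a t) ≤ ∑ s ∈ Finset.Icc 1 n, (s : ℝ) * (a s - a (s - 1)) := by
  induction n with
  | zero =>
    have := ha (Nat.zero_le t)
    simp only [Nat.lt_one_iff, Finset.Icc_eq_empty_of_lt, Finset.sum_empty]
    exact mul_nonpos_of_nonneg_of_nonpos (by positivity) (by linarith)
  | succ n ih =>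
    rw [Finset.sum_Icc_succ_top (by omega), Nat.add_sub_cancel]
    have h := ha (Nat.le_succ n)
    rcases le_or_gt t n with htn | htn
    · have htn' : (t : ℝ) ≤ n := by exact_mod_cast htn
      push_cast
      have := mul_le_mul_of_nonneg_right (add_le_add_left htn' 1) (sub_nonneg.mpr h)
      simp only [Nat.succ_eq_add_one] at *
      linarith
    · have h1 := ha (Nat.succ_le_of_lt htn)
      have h2 : (t + 1 : ℝ) * (a (n + 1) - a t) ≤ 0 :=
        mul_nonpos_of_nonneg_of_nonpos (by positivity) (by simpa using h1)
      exact h2.trans (add_nonneg (Finset.sum_nonneg fun s _ => mul_nonneg (Nat.cast_nonneg s)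
        (sub_nonneg.mpr (ha (Nat.sub_le s 1)))) (mul_nonneg (Nat.cast_nonneg _) (sub_nonneg.mpr h)))

/-- A Markov inequality: the part of `v` outside the `t`-fattening has distance at least `t + 1`. -/
theorem le_expect_distanceOp {V : Submodule ℂ (Vec Q)} (hV : V ≠ ⊥) (t : ℕ) (v : Vec Q) :
    (t + 1 : ℝ) * ‖v - (fattening V t).starProjection v‖ ^ 2 ≤ expect (distanceOp V) v := by
  have hpy : ∀ K : Submodule ℂ (Vec Q),
      ‖v‖ ^ 2 = ‖K.starProjection v‖ ^ 2 + ‖v - K.starProjection v‖ ^ 2 := fun K => by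
    have := Submodule.norm_sq_eq_add_norm_sq_starProjection v K
    simpa [Submodule.starProjection_orthogonal_val] using this
  have hmono : Monotone fun s => ‖(fattening V s).starProjection v‖ ^ 2 := fun s s' hs => by
    have h := congrArg (fun T => T v)
      (Submodule.starProjection_comp_starProjection_of_le (fattening_mono V hs))
    simp only [ContinuousLinearMap.comp_apply] at h
    simp only [← h]
    gcongr
    exact Submodule.norm_starProjection_apply_le _ _
  have h := le_sum_mul_sub hmono t (Fintype.card Q)
  simp only [distanceOp, expect_sum, expect_smul, expect_sub, expect_projMatrix]
  refine le_trans (le_of_eq ?_) h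
  rw [fattening_card_eq_top hV]
  simp only [Submodule.starProjection_top, ContinuousLinearMap.id_apply]
  rw [hpy (fattening V t)]
  ring

end Distance

end QCode

namespace QCode

/-! ### Pauli operators and the Hadamard transform. -/

section Pauli

/-- The nontrivial character of `ZMod 2`. -/
noncomputable def signChar (a : ZMod 2) : ℂ := if a = 0 then 1 else -1

theorem zmod_two_cases (a : ZMod 2) : a = 0 ∨ a = 1 := by
  revert a; decide

theorem signChar_zero : signChar 0 = 1 := if_pos rfl

theorem signChar_one : signChar 1 = -1 := if_neg one_ne_zero

theorem signChar_add (a b : ZMod 2) : signChar (a + b) = signChar a * signChar b := by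
  have h : (1 + 1 : ZMod 2) = 0 := by decide
  rcases zmod_two_cases a with rfl | rfl <;> rcases zmod_two_cases b with rfl | rfl <;>
    simp [signChar_zero, signChar_one, h]

theorem signChar_sum {ι : Type*} (s : Finset ι) (f : ι → ZMod 2) :
    signChar (∑ i ∈ s, f i) = ∏ i ∈ s, signChar (f i) := by
  classical
  induction s using Finset.induction_on with
  | empty => simp [signChar_zero]
  | insert i s hi ih => rw [Finset.sum_insert hi, Finset.prod_insert hi, signChar_add, ih]

theorem tensor_mul {Q : Type} [Fintype Q] [DecidableEq Q]
    (A B : Q → Matrix (ZMod 2) (ZMod 2) ℂ) :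
    tensor A * tensor B = tensor fun i => A i * B i := by
  ext x y
  simp only [tensor, Matrix.mul_apply, Matrix.of_apply, ← Finset.prod_mul_distrib]
  rw [Finset.prod_univ_sum]
  simp

theorem tensor_diagonal {Q : Type} [Fintype Q] [DecidableEq Q] (d : Q → ZMod 2 → ℂ) :
    (tensor fun i => Matrix.diagonal (d i)) = Matrix.diagonal fun x => ∏ i, d i (x i) := by
  ext x y
  simp only [tensor, Matrix.of_apply, Matrix.diagonal_apply, Finset.prod_ite_zero, funext_iff,
    Finset.mem_univ, true_implies]

theorem tensor_one {Q : Type} [Fintype Q] [DecidableEq Q] :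
    (tensor fun _ : Q => 1) = (1 : Op Q) := by
  simp only [← Matrix.diagonal_one, tensor_diagonal, Finset.prod_const_one]

variable {n : ℕ}

theorem zOp_eq_diagonal (z : Bits (Fin n)) :
    zOp z = Matrix.diagonal fun y => signChar (z ⬝ᵥ y) := by
  have h : ∀ i, (if z i = 0 then (1 : Matrix (ZMod 2) (ZMod 2) ℂ) else pauliZ) =
      Matrix.diagonal fun a => signChar (z i * a) := fun i => by
    rcases zmod_two_cases (z i) with h | h
    · simp [h, signChar_zero]
    · simp [h, pauliZ, signChar]
  simp only [zOp, h, tensor_diagonal, dotProduct, signChar_sum]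

theorem zOp_apply_coord (z : Bits (Fin n)) (ψ : Vec (Fin n)) (y : Bits (Fin n)) :
    apply (zOp z) ψ y = signChar (z ⬝ᵥ y) * ψ y := by
  rw [zOp_eq_diagonal, apply_diagonal_coord]

theorem xOp_apply_coord (x : Bits (Fin n)) (ψ : Vec (Fin n)) (y : Bits (Fin n)) :
    apply (xOp x) ψ y = ψ (y + x) := by
  have h : ∀ i a b, (if x i = 0 then (1 : Matrix (ZMod 2) (ZMod 2) ℂ) else pauliX) a b =
      if b = a + x i then 1 else 0 := fun i a b => by
    have h2 : (1 + 1 : ZMod 2) = 0 := by decide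
    rcases zmod_two_cases (x i) with h | h <;> rcases zmod_two_cases a with rfl | rfl <;>
      rcases zmod_two_cases b with rfl | rfl <;> simp [h, h2, pauliX]
  have h' : ∀ w : Bits (Fin n), xOp x y w = if w = y + x then 1 else 0 := fun w => by
    simp only [xOp, tensor, Matrix.of_apply, h, Finset.prod_ite_zero, Finset.prod_const_one,
      Finset.mem_univ, true_implies, funext_iff, Pi.add_apply]
  simp [apply_coord, h']

theorem zOp_xOp_anticommute {x z : Bits (Fin n)} (hxz : z ⬝ᵥ x = 1) (ψ : Vec (Fin n)) :
    apply (zOp z) (apply (xOp x) ψ) = -apply (xOp x) (apply (zOp z) ψ) := by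
  ext y
  rw [PiLp.neg_apply, zOp_apply_coord, xOp_apply_coord, xOp_apply_coord, zOp_apply_coord,
    dotProduct_add, hxz, signChar_add, signChar_one]
  ring

/-- The one-qubit Hadamard gate. -/
noncomputable def hadamard : Matrix (ZMod 2) (ZMod 2) ℂ :=
  Matrix.of fun a b => ((Real.sqrt 2)⁻¹ : ℝ) * signChar (a * b)

theorem inv_sqrt_two_mul_self : (((Real.sqrt 2)⁻¹ : ℝ) : ℂ) * ((Real.sqrt 2)⁻¹ : ℝ) = 1 / 2 := by
  rw [← Complex.ofReal_mul, ← mul_inv, Real.mul_self_sqrt zero_le_two]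
  norm_num

theorem hadamard_mul_apply (M : Matrix (ZMod 2) (ZMod 2) ℂ) (a b : ZMod 2) :
    (hadamard * M * hadamard) a b = 1 / 2 * (M 0 0 + signChar b * M 0 1 + signChar a * M 1 0 +
      signChar a * signChar b * M 1 1) := by
  have h : ∀ f : ZMod 2 → ℂ, ∑ i, f i = f 0 + f 1 := fun f => Fin.sum_univ_two f
  rw [Matrix.mul_apply, h, Matrix.mul_apply, Matrix.mul_apply, h, h, ← inv_sqrt_two_mul_self]
  simp only [hadamard, Matrix.of_apply, mul_zero, mul_one, zero_mul, one_mul, signChar_zero]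
  ring

theorem hadamard_mul_self : hadamard * hadamard = 1 := by
  have h := fun a b => hadamard_mul_apply 1 a b
  rw [mul_one] at h
  ext a b
  rw [h]
  rcases zmod_two_cases a with rfl | rfl <;> rcases zmod_two_cases b with rfl | rfl <;>
    simp [signChar_zero, signChar_one] <;> norm_num

theorem hadamard_conj_pauliZ : hadamard * pauliZ * hadamard = pauliX := by
  ext a b
  rw [hadamard_mul_apply]
  rcases zmod_two_cases a with rfl | rfl <;> rcases zmod_two_cases b with rfl | rfl <;>
    simp [signChar_zero, signChar_one, pauliZ, pauliX] <;> norm_num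

theorem hadamard_conjTranspose : hadamardᴴ = hadamard := by
  ext a b
  rw [Matrix.conjTranspose_apply]
  simp only [hadamard, Matrix.of_apply, star_mul', mul_comm b a]
  congr 1
  · exact Complex.conj_ofReal _
  · rw [signChar]
    split_ifs <;> simp

/-- The Hadamard transform on a register. -/
noncomputable def hadamardOp (Q : Type) [Fintype Q] [DecidableEq Q] : Op Q :=
  tensor fun _ => hadamard

theorem hadamardOp_mul_self {Q : Type} [Fintype Q] [DecidableEq Q] :
    hadamardOp Q * hadamardOp Q = 1 := by
  simp only [hadamardOp, tensor_mul, hadamard_mul_self, tensor_one]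

theorem hadamardOp_conjTranspose {Q : Type} [Fintype Q] [DecidableEq Q] :
    (hadamardOp Q)ᴴ = hadamardOp Q := by
  ext x y
  simp only [hadamardOp, tensor, Matrix.conjTranspose_apply, Matrix.of_apply, star_prod]
  refine Finset.prod_congr rfl fun i _ => ?_
  rw [← Matrix.conjTranspose_apply, hadamard_conjTranspose]

theorem apply_hadamardOp_twice {Q : Type} [Fintype Q] [DecidableEq Q] (ψ : Vec Q) :
    apply (hadamardOp Q) (apply (hadamardOp Q) ψ) = ψ := by
  rw [← apply_mul, hadamardOp_mul_self, apply_one]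

theorem hadamardOp_conj_tensor {Q : Type} [Fintype Q] [DecidableEq Q]
    (A : Q → Matrix (ZMod 2) (ZMod 2) ℂ) :
    hadamardOp Q * tensor A * hadamardOp Q = tensor fun i => hadamard * A i * hadamard := by
  simp only [hadamardOp, tensor_mul]

theorem hadamardOp_conj_zOp (e : Bits (Fin n)) :
    hadamardOp (Fin n) * zOp e * hadamardOp (Fin n) = xOp e := by
  rw [zOp, hadamardOp_conj_tensor, xOp]
  congr 1
  funext i
  split_ifs
  · rw [mul_one, hadamard_mul_self]
  · exact hadamard_conj_pauliZ

theorem hadamardOp_zOp (e : Bits (Fin n)) :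
    hadamardOp (Fin n) * zOp e = xOp e * hadamardOp (Fin n) := by
  rw [← hadamardOp_conj_zOp, mul_assoc, mul_assoc, hadamardOp_mul_self, mul_one]

theorem hadamardOp_xOp (e : Bits (Fin n)) :
    hadamardOp (Fin n) * xOp e = zOp e * hadamardOp (Fin n) := by
  rw [← hadamardOp_conj_zOp, ← mul_assoc, ← mul_assoc, hadamardOp_mul_self, one_mul]

end Pauli

/-! ### CSS codes and the exchange of `X` and `Z`. -/

section Code

variable {n : ℕ}

namespace CSSCode

/-- The code with the roles of `X` and `Z` exchanged. -/
def swap (C : CSSCode n) : CSSCode n where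
  Hx := C.Hz
  Hz := C.Hx
  orthogonal x hx z hz := by rw [dotProduct_comm]; exact C.orthogonal z hz x hx

variable (C : CSSCode n)

theorem minDistance_swap : C.swap.minDistance = C.minDistance := by
  rw [minDistance, minDistance]
  congr 1
  ext t
  refine exists_congr fun w => and_congr_left fun _ => ?_
  exact or_comm

theorem Sx_le_dual_Sz : C.Sx ≤ dual C.Sz := by
  refine Submodule.span_le.mpr fun x hx z hz => ?_
  rw [dotProduct_comm]
  induction hz using Submodule.span_induction with
  | mem z hz => exact C.orthogonal x hx z hz
  | zero => exact dotProduct_zero x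
  | add a b _ _ ha hb => rw [dotProduct_add, ha, hb, add_zero]
  | smul c a _ ha => rw [dotProduct_smul, ha, smul_zero]

variable {C}

theorem zOp_mem_codeSpace {z : Bits (Fin n)} (hz : z ∈ dual C.Sx) {ψ : Vec (Fin n)}
    (hψ : ψ ∈ C.codeSpace) : apply (zOp z) ψ ∈ C.codeSpace := by
  refine ⟨fun s hs => ?_, fun s hs => ?_⟩
  · ext y
    have h := congrArg (fun φ : Vec (Fin n) => φ y) (hψ.1 s hs)
    simp only [xOp_apply_coord] at h
    rw [xOp_apply_coord, zOp_apply_coord, zOp_apply_coord, h, dotProduct_add, dotProduct_comm z s,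
      hz s hs, add_zero]
  · ext y
    have h := congrArg (fun φ : Vec (Fin n) => φ y) (hψ.2 s hs)
    simp only [zOp_apply_coord] at h
    rw [zOp_apply_coord, zOp_apply_coord, mul_left_comm, h]

theorem mem_dual_Sz_of_ne_zero {ψ : Vec (Fin n)} (hψ : ψ ∈ C.codeSpace) {y : Bits (Fin n)}
    (hy : ψ y ≠ 0) : y ∈ dual C.Sz := fun s hs => by
  have h := congrArg (fun φ : Vec (Fin n) => φ y) (hψ.2 s hs)
  simp only [zOp_apply_coord] at h
  rcases zmod_two_cases (s ⬝ᵥ y) with h0 | h1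
  · exact h0
  · rw [h1, signChar_one] at h
    exact absurd (by linear_combination (-1 / 2 : ℂ) * h) hy

theorem codeSpace_ne_bot : C.codeSpace ≠ ⊥ := by
  classical
  rw [Submodule.ne_bot_iff]
  -- The witness is the unnormalized uniform superposition of `S_x`.
  refine ⟨WithLp.toLp 2 fun y => if y ∈ C.Sx then 1 else 0, ⟨fun x hx => ?_, fun z hz => ?_⟩, ?_⟩
  · ext y
    rw [xOp_apply_coord]
    simp only [C.Sx.add_mem_iff_left hx]
  · ext y
    rw [zOp_apply_coord]
    by_cases hy : y ∈ C.Sx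
    · simp [C.Sx_le_dual_Sz hy z hz, signChar_zero]
    · simp [hy]
  · intro h
    have := congrArg (fun φ : Vec (Fin n) => φ 0) h
    simp at this

theorem hadamardOp_mem_codeSpace_swap {ψ : Vec (Fin n)} (hψ : ψ ∈ C.codeSpace) :
    apply (hadamardOp (Fin n)) ψ ∈ C.swap.codeSpace := by
  refine ⟨fun x hx => ?_, fun z hz => ?_⟩
  · rw [← apply_mul, ← hadamardOp_zOp, apply_mul, hψ.2 x hx]
  · rw [← apply_mul, ← hadamardOp_xOp, apply_mul, hψ.1 z hz]

theorem ncard_hadamard_conj_le (A : Fin n → Matrix (ZMod 2) (ZMod 2) ℂ) :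
    {i | hadamard * A i * hadamard ≠ 1}.ncard ≤ {i | A i ≠ 1}.ncard :=
  Set.ncard_le_ncard (fun i hi h => hi (by rw [h, mul_one, hadamard_mul_self])) (Set.toFinite _)

/-- The Hadamard transform is a product operator, so conjugation by it keeps the number of
nontrivial tensor factors. Every statement about the `Z`-decoder thus yields one about the
`X`-decoder. -/
theorem hadamardOp_mem_fattening_swap {t : ℕ} {φ : Vec (Fin n)}
    (hφ : φ ∈ fattening C.codeSpace t) :
    apply (hadamardOp (Fin n)) φ ∈ fattening C.swap.codeSpace t := by
  induction hφ using Submodule.span_induction with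
  | mem φ hφ =>
    obtain ⟨A, ψ, hψ, hA, rfl⟩ := hφ
    refine Submodule.subset_span ⟨_, _, hadamardOp_mem_codeSpace_swap hψ,
      (ncard_hadamard_conj_le A).trans hA, ?_⟩
    rw [← hadamardOp_conj_tensor, apply_mul, apply_mul, apply_hadamardOp_twice]
  | zero => rw [apply_zero]; exact zero_mem _
  | add a b _ _ ha hb => rw [apply_vec_add]; exact add_mem ha hb
  | smul c a _ ha => rw [apply_vec_smul]; exact Submodule.smul_mem _ _ ha

/-! ### Decoding observables on the fattened code. -/

open Classical in
/-- The bit strings within distance `t` of a vector of `S_z^⊥` with `Z`-logical value `b`. -/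
noncomputable def decodeRegion (C : CSSCode n) (z : Bits (Fin n)) (t : ℕ) (b : ZMod 2) :
    Finset (Bits (Fin n)) :=
  Finset.univ.filter fun y => ∃ u ∈ dual C.Sz, z ⬝ᵥ u = b ∧ hammingDist y u ≤ t

theorem mem_decodeRegion {z : Bits (Fin n)} {t : ℕ} {b : ZMod 2} {y : Bits (Fin n)} :
    y ∈ C.decodeRegion z t b ↔ ∃ u ∈ dual C.Sz, z ⬝ᵥ u = b ∧ hammingDist y u ≤ t := by
  simp [decodeRegion]

/-- The difference of the two nearby vectors lies in `S_z^⊥` and pairs to `1` with `z ∈ S_x^⊥`, so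
it is not in `S_x` and its weight is at least the minimum distance. -/
theorem minDistance_le_of_mem_decodeRegion {z : Bits (Fin n)} (hz : z ∈ dual C.Sx) {t : ℕ}
    {b b' : ZMod 2} (hbb : b ≠ b') {y y' : Bits (Fin n)} (hy : y ∈ C.decodeRegion z t b)
    (hy' : y' ∈ C.decodeRegion z t b') : C.minDistance ≤ hammingDist y y' + 2 * t := by
  obtain ⟨u, hu, rfl, hyu⟩ := mem_decodeRegion.mp hy
  obtain ⟨u', hu', rfl, hyu'⟩ := mem_decodeRegion.mp hy'
  have hw : C.minDistance ≤ hammingNorm (u - u') := by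
    refine Nat.sInf_le ⟨u - u', Or.inr ⟨sub_mem hu hu', fun h => hbb ?_⟩, rfl⟩
    have := hz _ h
    rw [dotProduct_comm, dotProduct_sub] at this
    exact sub_eq_zero.mp this
  have hnorm : hammingNorm (u - u') = hammingDist u u' := by
    simp [hammingNorm, hammingDist, sub_ne_zero]
  rw [hnorm] at hw
  have h1 := hammingDist_triangle u y u'
  have h2 := hammingDist_triangle y y' u'
  rw [hammingDist_comm u y] at h1
  omega

open Classical in
/-- The observable that decodes the `Z`-logical value of a bit string. -/
noncomputable def decodeSign (C : CSSCode n) (z : Bits (Fin n)) (t : ℕ) : Op (Fin n) :=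
  -- Undecodable strings also get the value `-1`; this keeps the observable an involution, and
  -- vectors of the fattened code vanish on these strings.
  Matrix.diagonal fun y => ((if y ∈ C.decodeRegion z t 0 then 1 else -1 : ℝ) : ℂ)

theorem decodeSign_conjTranspose (z : Bits (Fin n)) (t : ℕ) :
    (C.decodeSign z t)ᴴ = C.decodeSign z t := by
  rw [decodeSign, Matrix.diagonal_conjTranspose]
  congr 1
  funext y
  exact Complex.conj_ofReal _

theorem decodeSign_mul_self (z : Bits (Fin n)) (t : ℕ) :
    C.decodeSign z t * C.decodeSign z t = 1 := by
  rw [decodeSign, Matrix.diagonal_mul_diagonal, ← Matrix.diagonal_one]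
  congr 1
  funext y
  split_ifs <;> simp

theorem tensor_apply_eq_zero_or {Q : Type} [Fintype Q] [DecidableEq Q]
    (A : Q → Matrix (ZMod 2) (ZMod 2) ℂ) (x y : Bits Q) :
    tensor A x y = 0 ∨ hammingDist x y ≤ {i | A i ≠ 1}.ncard := by
  by_cases h : ∀ i, A i = 1 → x i = y i
  · right
    rw [hammingDist, ← Set.ncard_coe_finset]
    refine Set.ncard_le_ncard (fun i hi => ?_) (Set.toFinite _)
    exact fun hA => (Finset.mem_filter.mp (Finset.mem_coe.mp hi)).2 (h i hA)
  · left
    push Not at h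
    obtain ⟨i, hA, hne⟩ := h
    exact Finset.prod_eq_zero (Finset.mem_univ i) (by rw [hA, Matrix.one_apply_ne hne])

/-- The decoder reads the logical value of a code state through errors of weight at most `t`. -/
theorem decodeSign_apply {z : Bits (Fin n)} (hz : z ∈ dual C.Sx) {t : ℕ}
    (ht : 2 * t < C.minDistance) {A : Fin n → Matrix (ZMod 2) (ZMod 2) ℂ}
    (hA : {i | A i ≠ 1}.ncard ≤ t) {ψ : Vec (Fin n)} (hψ : ψ ∈ C.codeSpace) :
    apply (C.decodeSign z t) (apply (tensor A) ψ) = apply (tensor A) (apply (zOp z) ψ) := by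
  ext y
  rw [decodeSign, apply_diagonal_coord, apply_coord, apply_coord, Finset.mul_sum]
  refine Finset.sum_congr rfl fun w _ => ?_
  rw [zOp_apply_coord]
  by_cases hw : ψ w = 0
  · simp [hw]
  rcases tensor_apply_eq_zero_or A y w with h | h
  · simp [h]
  -- An error of weight at most `t` moves `w`, which lies in `S_z^⊥`, to a string at distance at
  -- most `t`; so `y` decodes to the logical value of `w`, and to no other since `2 t` is below the
  -- minimum distance.
  have hmem : y ∈ C.decodeRegion z t (z ⬝ᵥ w) :=
    mem_decodeRegion.mpr ⟨w, mem_dual_Sz_of_ne_zero hψ hw, rfl, h.trans hA⟩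
  rcases zmod_two_cases (z ⬝ᵥ w) with h0 | h1
  · rw [h0] at hmem ⊢
    rw [if_pos hmem, signChar_zero]
    push_cast
    ring
  · rw [h1] at hmem ⊢
    rw [if_neg, signChar_one]
    · push_cast
      ring
    · intro h0
      have := minDistance_le_of_mem_decodeRegion hz zero_ne_one h0 hmem
      rw [hammingDist_self] at this
      omega

theorem apply_eq_zero_of_mem_fattening {z : Bits (Fin n)} {t : ℕ} {φ : Vec (Fin n)}
    (hφ : φ ∈ fattening C.codeSpace t) {y : Bits (Fin n)}
    (h0 : y ∉ C.decodeRegion z t 0) (h1 : y ∉ C.decodeRegion z t 1) : φ y = 0 := by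
  induction hφ using Submodule.span_induction with
  | mem φ hφ =>
    obtain ⟨A, ψ, hψ, hA, rfl⟩ := hφ
    rw [apply_coord]
    refine Finset.sum_eq_zero fun w _ => ?_
    by_cases hw : ψ w = 0
    · rw [hw, mul_zero]
    rcases tensor_apply_eq_zero_or A y w with h | h
    · rw [h, zero_mul]
    have hmem : y ∈ C.decodeRegion z t (z ⬝ᵥ w) :=
      mem_decodeRegion.mpr ⟨w, mem_dual_Sz_of_ne_zero hψ hw, rfl, h.trans hA⟩
    rcases zmod_two_cases (z ⬝ᵥ w) with hb | hb <;> rw [hb] at hmem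
    · exact absurd hmem h0
    · exact absurd hmem h1
  | zero => rfl
  | add a b _ _ ha hb => rw [PiLp.add_apply, ha, hb, add_zero]
  | smul c a _ ha => rw [PiLp.smul_apply, ha, smul_zero]

/-- The observable that decodes the `X`-logical value. -/
noncomputable def decodeSignX (C : CSSCode n) (x : Bits (Fin n)) (t : ℕ) : Op (Fin n) :=
  hadamardOp (Fin n) * C.swap.decodeSign x t * hadamardOp (Fin n)

theorem decodeSignX_conjTranspose (x : Bits (Fin n)) (t : ℕ) :
    (C.decodeSignX x t)ᴴ = C.decodeSignX x t := by
  rw [decodeSignX, Matrix.conjTranspose_mul, Matrix.conjTranspose_mul, hadamardOp_conjTranspose,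
    decodeSign_conjTranspose, mul_assoc]

theorem decodeSignX_mul_self (x : Bits (Fin n)) (t : ℕ) :
    C.decodeSignX x t * C.decodeSignX x t = 1 := by
  calc C.decodeSignX x t * C.decodeSignX x t
      = hadamardOp (Fin n) * (C.swap.decodeSign x t * (hadamardOp (Fin n) * hadamardOp (Fin n)) *
          C.swap.decodeSign x t) * hadamardOp (Fin n) := by simp only [decodeSignX, mul_assoc]
    _ = 1 := by
      rw [hadamardOp_mul_self, mul_one, decodeSign_mul_self, mul_one, hadamardOp_mul_self]

theorem decodeSignX_apply {x : Bits (Fin n)} (hx : x ∈ dual C.Sz) {t : ℕ}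
    (ht : 2 * t < C.minDistance) {A : Fin n → Matrix (ZMod 2) (ZMod 2) ℂ}
    (hA : {i | A i ≠ 1}.ncard ≤ t) {ψ : Vec (Fin n)} (hψ : ψ ∈ C.codeSpace) :
    apply (C.decodeSignX x t) (apply (tensor A) ψ) = apply (tensor A) (apply (xOp x) ψ) := by
  have h := decodeSign_apply (C := C.swap) (z := x) hx (by rwa [minDistance_swap])
    ((ncard_hadamard_conj_le A).trans hA) (hadamardOp_mem_codeSpace_swap hψ)
  rw [← hadamardOp_conj_tensor] at h
  simp only [apply_mul, apply_hadamardOp_twice] at h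
  rw [decodeSignX, apply_mul, apply_mul, h, apply_hadamardOp_twice, ← apply_mul _ (zOp x),
    ← apply_mul _ (hadamardOp (Fin n)), hadamardOp_conj_zOp]

theorem xOp_mem_codeSpace {x : Bits (Fin n)} (hx : x ∈ dual C.Sz) {ψ : Vec (Fin n)}
    (hψ : ψ ∈ C.codeSpace) : apply (xOp x) ψ ∈ C.codeSpace := by
  have h := hadamardOp_mem_codeSpace_swap (C := C.swap)
    (zOp_mem_codeSpace (C := C.swap) hx (hadamardOp_mem_codeSpace_swap hψ))
  rw [← hadamardOp_conj_zOp, apply_mul, apply_mul]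
  exact h

theorem decodeSign_mem_fattening {z : Bits (Fin n)} (hz : z ∈ dual C.Sx) {t : ℕ}
    (ht : 2 * t < C.minDistance) {φ : Vec (Fin n)} (hφ : φ ∈ fattening C.codeSpace t) :
    apply (C.decodeSign z t) φ ∈ fattening C.codeSpace t := by
  induction hφ using Submodule.span_induction with
  | mem φ hφ =>
    obtain ⟨A, ψ, hψ, hA, rfl⟩ := hφ
    rw [decodeSign_apply hz ht hA hψ]
    exact Submodule.subset_span ⟨A, _, zOp_mem_codeSpace hz hψ, hA, rfl⟩
  | zero => rw [apply_zero]; exact zero_mem _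
  | add a b _ _ ha hb => rw [apply_vec_add]; exact add_mem ha hb
  | smul c a _ ha => rw [apply_vec_smul]; exact Submodule.smul_mem _ _ ha

theorem decodeSignX_mem_fattening {x : Bits (Fin n)} (hx : x ∈ dual C.Sz) {t : ℕ}
    (ht : 2 * t < C.minDistance) {φ : Vec (Fin n)} (hφ : φ ∈ fattening C.codeSpace t) :
    apply (C.decodeSignX x t) φ ∈ fattening C.codeSpace t := by
  have h := hadamardOp_mem_fattening_swap (C := C.swap)
    (decodeSign_mem_fattening (C := C.swap) hx (by rwa [minDistance_swap])
      (hadamardOp_mem_fattening_swap hφ))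
  rw [decodeSignX, apply_mul, apply_mul]
  exact h

/-- On generators of the fattening the decoders pass through the error and become `zOp z` and `xOp
x` on the code space. -/
theorem decodeSign_decodeSignX_anticommute {x z : Bits (Fin n)} (hx : x ∈ dual C.Sz)
    (hz : z ∈ dual C.Sx) (hxz : z ⬝ᵥ x = 1) {t : ℕ} (ht : 2 * t < C.minDistance)
    {φ : Vec (Fin n)} (hφ : φ ∈ fattening C.codeSpace t) :
    apply (C.decodeSign z t) (apply (C.decodeSignX x t) φ) =
      -apply (C.decodeSignX x t) (apply (C.decodeSign z t) φ) := by
  induction hφ using Submodule.span_induction with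
  | mem φ hφ =>
    obtain ⟨A, ψ, hψ, hA, rfl⟩ := hφ
    rw [decodeSignX_apply hx ht hA hψ, decodeSign_apply hz ht hA hψ,
      decodeSign_apply hz ht hA (xOp_mem_codeSpace hx hψ),
      decodeSignX_apply hx ht hA (zOp_mem_codeSpace hz hψ), zOp_xOp_anticommute hxz]
    exact map_neg _ _
  | zero => simp only [apply_zero, neg_zero]
  | add a b _ _ ha hb => simp only [apply_vec_add, ha, hb, neg_add]
  | smul c a _ ha => simp only [apply_vec_smul, ha, smul_neg]

/-- A code with a logical qubit has a pair of anticommuting logical operators. -/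
theorem exists_logical_pair (hk : 1 ≤ C.logicalQubits) :
    ∃ x ∈ dual C.Sz, ∃ z ∈ dual C.Sx, z ⬝ᵥ x = 1 := by
  obtain ⟨z, hz, hzS⟩ : ∃ z ∈ dual C.Sx, z ∉ C.Sz := by
    by_contra! h
    have htop : C.Sz.submoduleOf (dual C.Sx) = ⊤ := by
      rw [eq_top_iff]
      exact fun z _ => h z z.2
    rw [logicalQubits, htop] at hk
    have := Module.finrank_zero_of_subsingleton (R := ZMod 2)
      (M := dual C.Sx ⧸ (⊤ : Submodule (ZMod 2) (dual C.Sx)))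
    omega
  -- A functional that vanishes on `S_z` but not at `z` is the pairing with a vector `x`, which is
  -- then in `S_z^⊥`.
  obtain ⟨f, hf, hker⟩ := Submodule.exists_le_ker_of_notMem hzS
  set x : Bits (Fin n) := fun i => f (Pi.single i 1) with hx
  have hfx : ∀ w, f w = w ⬝ᵥ x := fun w => by
    conv_lhs => rw [pi_eq_sum_univ' w, map_sum]
    refine Finset.sum_congr rfl fun i _ => ?_
    rw [map_smul, smul_eq_mul, hx]
  refine ⟨x, fun w hw => ?_, z, hz, ?_⟩
  · rw [← hfx]
    exact hker hw
  · rw [← hfx]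
    exact (zmod_two_cases _).resolve_left hf

end CSSCode

end Code

end QCode

namespace QCode

/-! ### Locality of operators. -/

section Locality

variable {Q : Type} [Fintype Q] [DecidableEq Q]

theorem ActsOn.mono {S T : Finset Q} {A : Op Q} (hA : ActsOn S A) (hST : S ⊆ T) :
    ActsOn T A := by
  classical
  obtain ⟨h, hA⟩ := hA
  refine ⟨Matrix.of fun u v => if ∀ q : T, q.1 ∉ S → u q = v q then
    h (fun s => u ⟨s, hST s.2⟩) (fun s => v ⟨s, hST s.2⟩) else 0, fun x y => ?_⟩
  rw [hA, Matrix.of_apply]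
  have hiff : (∀ q, q ∉ S → x q = y q) ↔ (∀ q, q ∉ T → x q = y q) ∧
      ∀ q : T, q.1 ∉ S → restrict x T q = restrict y T q := by
    refine ⟨fun H => ⟨fun q hq => H q fun h => hq (hST h), fun q hq => H q hq⟩, fun H q hq => ?_⟩
    by_cases hT : q ∈ T
    · exact H.2 ⟨q, hT⟩ hq
    · exact H.1 q hT
  simp only [hiff, ite_and]
  rfl

theorem ActsOn.add {S : Finset Q} {A B : Op Q} (hA : ActsOn S A) (hB : ActsOn S B) :
    ActsOn S (A + B) := by
  obtain ⟨h, hA⟩ := hA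
  obtain ⟨k, hB⟩ := hB
  refine ⟨h + k, fun x y => ?_⟩
  rw [Matrix.add_apply, hA, hB]
  split_ifs <;> simp

theorem ActsOn.smul {S : Finset Q} {A : Op Q} (c : ℝ) (hA : ActsOn S A) : ActsOn S (c • A) := by
  obtain ⟨h, hA⟩ := hA
  refine ⟨c • h, fun x y => ?_⟩
  rw [Matrix.smul_apply, hA]
  split_ifs <;> simp

theorem IsLocal.add {k l : ℕ} {A B : Op Q} (hA : IsLocal k A) (hB : IsLocal l B) :
    IsLocal (k + l) (A + B) := by
  obtain ⟨S, hS, hA⟩ := hA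
  obtain ⟨T, hT, hB⟩ := hB
  exact ⟨S ∪ T, (Finset.card_union_le _ _).trans (add_le_add hS hT),
    (hA.mono Finset.subset_union_left).add (hB.mono Finset.subset_union_right)⟩

theorem IsLocal.smul {k : ℕ} {A : Op Q} (c : ℝ) (hA : IsLocal k A) : IsLocal k (c • A) := by
  obtain ⟨S, hS, hA⟩ := hA
  exact ⟨S, hS, hA.smul c⟩

theorem isLocal_zero (k : ℕ) : IsLocal k (0 : Op Q) :=
  ⟨∅, by simp, 0, fun x y => by simp⟩

theorem isLocalHamiltonian_of_fintype {ι : Type*} [Fintype ι] {k : ℕ} {H : Op Q} (h : ι → Op Q)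
    (hh : ∀ i, (h i).PosSemidef ∧ (1 - h i).PosSemidef ∧ IsLocal k (h i))
    (hH : H = (1 / (Fintype.card ι : ℝ)) • ∑ i, h i) : IsLocalHamiltonian k H :=
  ⟨Fintype.card ι, fun j => h ((Fintype.equivFin ι).symm j), fun j => hh _, by
    rw [hH, Equiv.sum_comp (Fintype.equivFin ι).symm h]⟩

theorem posSemidef_of_isStarProjection {P : Op Q} (hP : IsStarProjection P) : P.PosSemidef := by
  have h := Matrix.posSemidef_conjTranspose_mul_self P
  rwa [← Matrix.star_eq_conjTranspose, hP.isSelfAdjoint.star_eq, hP.isIdempotentElem.eq] at h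

end Locality

/-! ### The code Hamiltonian: locality, soundness and ground energy. -/

namespace CSSCode

variable {n : ℕ} {C : CSSCode n} {q : ℕ} {ρ : ℝ}

theorem xCheck_zero : xCheck (0 : Bits (Fin n)) = 0 := by
  simp [xCheck, xOp, tensor_one]

theorem zCheck_zero : zCheck (0 : Bits (Fin n)) = 0 := by
  simp [zCheck, zOp, tensor_one]

/-- An average of checks is an average of checks over a nonempty set. -/
theorem exists_nonempty_average {f : Bits (Fin n) → Op (Fin n)} (hf : f 0 = 0)
    (H : Finset (Bits (Fin n)))
    (hH : ∀ e ∈ H, IsStarProjection (f e) ∧ IsLocal q (f e)) :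
    ∃ H' : Finset (Bits (Fin n)), H'.Nonempty ∧
      (∀ e ∈ H', IsStarProjection (f e) ∧ IsLocal q (f e)) ∧
      (1 / (2 * (H.card : ℝ))) • ∑ e ∈ H, f e = (1 / (2 * (H'.card : ℝ))) • ∑ e ∈ H', f e := by
  rcases H.eq_empty_or_nonempty with rfl | hne
  · refine ⟨{0}, Finset.singleton_nonempty _, fun e he => ?_, by simp [hf]⟩
    rw [Finset.mem_singleton.mp he, hf]
    exact ⟨.zero _, isLocal_zero q⟩
  · exact ⟨H, hne, hH, rfl⟩

theorem IsLocallyTestable.xCheck (h : C.IsLocallyTestable q ρ) {e : Bits (Fin n)}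
    (he : e ∈ C.Hx) : IsStarProjection (xCheck e) ∧ IsLocal q (xCheck e) := by
  obtain ⟨a, b, ha, hb, h⟩ := h
  exact ⟨h.projection (Sum.inl (⟨e, he⟩, ⟨0, ha⟩)), h.isLocal (Sum.inl (⟨e, he⟩, ⟨0, ha⟩))⟩

theorem IsLocallyTestable.zCheck (h : C.IsLocallyTestable q ρ) {e : Bits (Fin n)}
    (he : e ∈ C.Hz) : IsStarProjection (zCheck e) ∧ IsLocal q (zCheck e) := by
  obtain ⟨a, b, ha, hb, h⟩ := h
  exact ⟨h.projection (Sum.inr (⟨e, he⟩, ⟨0, hb⟩)), h.isLocal (Sum.inr (⟨e, he⟩, ⟨0, hb⟩))⟩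

/-- Pairing each `X`-check with each `Z`-check writes the Hamiltonian as a uniform average of
half-sums, which act on at most `2 q` qubits. -/
theorem IsLocallyTestable.isLocalHamiltonian (h : C.IsLocallyTestable q ρ) :
    IsLocalHamiltonian (q + q) C.hamiltonian := by
  obtain ⟨A, hA, hAp, hAs⟩ := exists_nonempty_average (f := CSSCode.xCheck) xCheck_zero C.Hx
    fun e he => h.xCheck he
  obtain ⟨B, hB, hBp, hBs⟩ := exists_nonempty_average (f := CSSCode.zCheck) zCheck_zero C.Hz
    fun e he => h.zCheck he
  refine isLocalHamiltonian_of_fintype (ι := A × B)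
    (fun i => (1 / 2 : ℝ) • (CSSCode.xCheck i.1.1 + CSSCode.zCheck i.2.1)) (fun i => ?_) ?_
  · obtain ⟨hx, hxl⟩ := hAp _ i.1.2
    obtain ⟨hz, hzl⟩ := hBp _ i.2.2
    refine ⟨?_, ?_, (hxl.add hzl).smul _⟩
    · exact ((posSemidef_of_isStarProjection hx).add (posSemidef_of_isStarProjection hz)).smul
        (by norm_num)
    · have : (1 : Op (Fin n)) - (1 / 2 : ℝ) • (CSSCode.xCheck i.1.1 + CSSCode.zCheck i.2.1) =
          (1 / 2 : ℝ) • ((1 - CSSCode.xCheck i.1.1) + (1 - CSSCode.zCheck i.2.1)) := by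
        module
      rw [this]
      exact ((posSemidef_of_isStarProjection hx.one_sub).add
        (posSemidef_of_isStarProjection hz.one_sub)).smul (by norm_num)
  · rw [hamiltonian, hAs, hBs, Fintype.card_prod, Fintype.card_coe, Fintype.card_coe,
      ← Finset.smul_sum, Fintype.sum_prod_type]
    simp only [Finset.sum_add_distrib, Finset.sum_const, Finset.card_univ, Fintype.card_coe,
      ← Finset.smul_sum]
    rw [Finset.sum_coe_sort A CSSCode.xCheck, Finset.sum_coe_sort B CSSCode.zCheck]
    have hA0 : (A.card : ℝ) ≠ 0 := by exact_mod_cast hA.card_pos.ne'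
    have hB0 : (B.card : ℝ) ≠ 0 := by exact_mod_cast hB.card_pos.ne'
    simp only [← Nat.cast_smul_eq_nsmul ℝ, smul_add, smul_smul]
    push_cast
    congr 2 <;> field_simp

/-- In the list of checks one type has total weight at most `1`, in the Hamiltonian `1 / 2`; hence a
factor `2`, whatever the multiplicities. -/
theorem average_le_average {X h a m : ℝ} (hX : 0 ≤ X) (hh : 0 ≤ h) (hX0 : h = 0 → X = 0)
    (ha : 0 < a) (hm : a * h ≤ m) : 1 / m * (a * X) ≤ 2 * (1 / (2 * h) * X) := by
  rcases hh.eq_or_lt with h0 | hpos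
  · simp [hX0 h0.symm]
  · have hah : 0 < a * h := mul_pos ha hpos
    calc 1 / m * (a * X) ≤ 1 / (a * h) * (a * X) := by gcongr
      _ = 2 * (1 / (2 * h) * X) := by field_simp

/-- The code Hamiltonian of a locally testable code dominates the distance operator. -/
theorem IsLocallyTestable.distanceOp_le (h : C.IsLocallyTestable q ρ) (v : Vec (Fin n)) :
    ρ / n * expect (distanceOp C.codeSpace) v ≤ 2 * expect C.hamiltonian v := by
  have hX : ∀ e ∈ C.Hx, 0 ≤ expect (CSSCode.xCheck e) v := fun e he =>
    expect_nonneg (posSemidef_of_isStarProjection (h.xCheck he).1) v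
  have hZ : ∀ e ∈ C.Hz, 0 ≤ expect (CSSCode.zCheck e) v := fun e he =>
    expect_nonneg (posSemidef_of_isStarProjection (h.zCheck he).1) v
  obtain ⟨a, b, ha, hb, h⟩ := h
  have hs := expect_nonneg h.sound v
  rw [expect_sub, expect_smul, expect_smul, expect_sum, Fintype.sum_sum_type,
    Fintype.sum_prod_type, Fintype.sum_prod_type] at hs
  simp only [checkList, Sum.elim_inl, Sum.elim_inr, Finset.sum_const, Finset.card_univ,
    Fintype.card_fin, Fintype.card_sum, Fintype.card_prod, Fintype.card_coe, nsmul_eq_mul,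
    ← Finset.mul_sum] at hs
  rw [Finset.sum_coe_sort C.Hx fun e => expect (CSSCode.xCheck e) v,
    Finset.sum_coe_sort C.Hz fun e => expect (CSSCode.zCheck e) v] at hs
  rw [hamiltonian, expect_add, expect_smul, expect_smul, expect_sum, expect_sum]
  push_cast at hs
  have h1 := average_le_average (m := C.Hx.card * a + C.Hz.card * b) (Finset.sum_nonneg hX)
    (Nat.cast_nonneg C.Hx.card)
    (fun h0 => by simp [Finset.card_eq_zero.mp (Nat.cast_eq_zero.mp h0)])
    (Nat.cast_pos.mpr ha) (by rw [mul_comm]; exact le_add_of_nonneg_right (by positivity))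
  have h2 := average_le_average (m := C.Hx.card * a + C.Hz.card * b) (Finset.sum_nonneg hZ)
    (Nat.cast_nonneg C.Hz.card)
    (fun h0 => by simp [Finset.card_eq_zero.mp (Nat.cast_eq_zero.mp h0)])
    (Nat.cast_pos.mpr hb) (by rw [mul_comm]; exact le_add_of_nonneg_left (by positivity))
  rw [mul_add] at hs
  linarith

theorem hamiltonian_apply_eq_zero {ψ : Vec (Fin n)} (hψ : ψ ∈ C.codeSpace) :
    apply C.hamiltonian ψ = 0 := by
  have hsum : ∀ (s : Finset (Bits (Fin n))) (f : Bits (Fin n) → Op (Fin n)),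
      (∀ e ∈ s, apply (f e) ψ = 0) → apply (∑ e ∈ s, f e) ψ = 0 := fun s f hf => by
    have : apply (∑ e ∈ s, f e) ψ = ∑ e ∈ s, apply (f e) ψ := by simp [apply]
    rw [this, Finset.sum_eq_zero hf]
  have hsub : ∀ A : Op (Fin n), apply A ψ = ψ → apply ((1 / 2 : ℝ) • (1 - A)) ψ = 0 :=
    fun A hA => by
      have : apply (1 - A) ψ = apply 1 ψ - apply A ψ := by simp [apply]
      rw [apply_real_smul, this, hA, apply_one, sub_self, smul_zero]
  rw [hamiltonian, apply_add, apply_real_smul, apply_real_smul,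
    hsum C.Hx xCheck fun e he => hsub _ (hψ.1 e (Submodule.subset_span he)),
    hsum C.Hz zCheck fun e he => hsub _ (hψ.2 e (Submodule.subset_span he)), smul_zero, smul_zero,
    add_zero]

/-- A nonzero code vector is in the kernel, so `0` is in the spectrum. Only this upper bound is
needed, since energies are bounded below absolutely. -/
theorem lambdaMin_hamiltonian_nonpos : lambdaMin C.hamiltonian ≤ 0 := by
  refine csInf_le (Matrix.finite_real_spectrum (A := C.hamiltonian)).bddBelow ?_
  rw [spectrum.zero_mem_iff]
  rintro ⟨u, hu⟩
  obtain ⟨ψ, hψ, hne⟩ := Submodule.ne_bot_iff _ |>.mp (codeSpace_ne_bot (C := C))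
  refine hne ?_
  have h : apply ((u⁻¹ : (Op (Fin n))ˣ).val * u.val) ψ = 0 := by
    rw [apply_mul, hu, hamiltonian_apply_eq_zero hψ, apply_zero]
  rwa [Units.inv_mul, apply_one] at h

end CSSCode

/-! ### Purified states, sliced by the ancilla outcome. -/

section Slices

variable {n : ℕ} {R : Type} [Fintype R] [DecidableEq R]

/-- The component with ancilla outcome `w` of the state that `W` prepares. -/
noncomputable def slice (W : Op (Fin n ⊕ R)) (w : Bits R) : Vec (Fin n) :=
  WithLp.toLp 2 fun y => W (Sum.elim y w) 0

theorem outcomeProb_eq_sum_slice (W : Op (Fin n ⊕ R)) (y : Bits (Fin n)) :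
    outcomeProb W y = ∑ w, ‖slice W w y‖ ^ 2 := rfl

theorem sum_norm_sq_slice {W : Op (Fin n ⊕ R)}
    (hW : W ∈ Matrix.unitaryGroup (Bits (Fin n ⊕ R)) ℂ) : ∑ w, ‖slice W w‖ ^ 2 = 1 := by
  simp only [EuclideanSpace.norm_sq_eq]
  rw [Finset.sum_comm, ← sum_norm_sq_unitary hW 0, sum_bits_sum]
  rfl

theorem sum_outcomeProb {W : Op (Fin n ⊕ R)}
    (hW : W ∈ Matrix.unitaryGroup (Bits (Fin n ⊕ R)) ℂ) : ∑ y, outcomeProb W y = 1 := by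
  rw [← sum_norm_sq_unitary hW 0, sum_bits_sum]
  rfl

/-- Tracing out the ancillas leaves the mixture of the unnormalized slices, so pure-state estimates
can be summed over `w`. -/
theorem energy_traceOut (H : Op (Fin n)) (U : Op (Fin n ⊕ R)) :
    energy H (traceOut (U * zeroState (Fin n ⊕ R) * Uᴴ)) = ∑ w, expect H (slice U w) := by
  have hent : ∀ x y, traceOut (U * zeroState (Fin n ⊕ R) * Uᴴ) x y =
      ∑ w, slice U w x * star (slice U w y) := fun x y => by
    rw [traceOut, Matrix.of_apply]
    refine Finset.sum_congr rfl fun w _ => ?_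
    rw [Matrix.mul_apply, Finset.sum_eq_single 0]
    · rw [Matrix.conjTranspose_apply, zeroState, Matrix.mul_apply, Finset.sum_eq_single 0]
      · simp [slice]
      · intro b _ hb
        simp [hb.symm]
      · simp
    · intro b _ hb
      rw [zeroState, Matrix.mul_apply, Finset.sum_eq_zero, zero_mul]
      intro c _
      simp [hb.symm]
    · simp
  have hexp : ∀ w, expect H (slice U w) =
      (∑ x, ∑ y, slice U w x * star (slice U w y) * H y x).re := fun w => by
    rw [expect_eq_dotProduct, Finset.sum_comm]
    congr 1
    refine Finset.sum_congr rfl fun y _ => ?_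
    rw [Matrix.mulVec, dotProduct, Finset.mul_sum]
    refine Finset.sum_congr rfl fun x _ => ?_
    simp only [Pi.star_apply]
    ring
  rw [energy, Matrix.trace]
  simp only [hexp, Matrix.diag_apply, Matrix.mul_apply, hent, ← Complex.re_sum, Finset.sum_mul]
  congr 1
  rw [Finset.sum_comm]
  conv_rhs => rw [Finset.sum_comm]
  rw [Finset.sum_comm]
  refine Finset.sum_congr rfl fun x _ => ?_
  rw [Finset.sum_comm]

/-- Hadamard gates on the first register do not enlarge the light cones. -/
theorem HasLightCones.exists_hadamard {U : Op (Fin n ⊕ R)} {b : ℕ}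
    {L : Fin n ⊕ R → Finset (Fin n ⊕ R)} (hU : HasLightCones U b L) :
    ∃ W L', HasLightCones (Q := Fin n ⊕ R) W b L' ∧
      ∀ w, slice W w = apply (hadamardOp (Fin n)) (slice U w) := by
  -- The Hadamard gates form a layer on singletons, for which the growth factor of `layer_mul` is
  -- `1`.
  set P : Finset (Finset (Fin n ⊕ R)) := Finset.univ.image fun i : Fin n => {Sum.inl i} with hP
  have h1 : ∀ e ∈ P, ∃ i : Fin n, {Sum.inl i} = e := fun e he => by simpa [hP] using he
  have hlay := hU.layer_mul (P := P) (g := fun e => hadamardOp e) le_rfl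
    (fun e he => by obtain ⟨i, rfl⟩ := h1 e he; simp)
    (fun e he f hf hef => by
      obtain ⟨i, rfl⟩ := h1 e he
      obtain ⟨j, rfl⟩ := h1 f hf
      simpa using fun h => hef (by rw [h]))
    (fun e _ => by
      rw [Matrix.mem_unitaryGroup_iff, Matrix.star_eq_conjTranspose, hadamardOp_conjTranspose,
        hadamardOp_mul_self])
  rw [one_mul] at hlay
  refine ⟨_, _, hlay, fun w => ?_⟩
  have hent : ∀ (y y' : Bits (Fin n)) (w' : Bits R),
      layerOp P (fun e => hadamardOp e) (Sum.elim y w) (Sum.elim y' w') =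
        if w' = w then hadamardOp (Fin n) y y' else 0 := fun y y' w' => by
    have hiff : (∀ q : Fin n ⊕ R, (∀ e ∈ P, q ∉ e) →
        (Sum.elim y w : Bits (Fin n ⊕ R)) q = (Sum.elim y' w' : Bits (Fin n ⊕ R)) q) ↔
          w' = w := by
      refine ⟨fun H => funext fun r => (H (Sum.inr r) (by simp [hP])).symm, ?_⟩
      rintro rfl (i | r) hq
      · exact absurd (Finset.mem_singleton_self _) (hq {Sum.inl i} (by simp [hP]))
      · rfl
    rw [layerOp_apply]
    simp only [hiff]
    refine if_congr Iff.rfl ?_ rfl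
    rw [hP, Finset.prod_image fun i _ j _ h => by simpa using h]
    refine Finset.prod_congr rfl fun i _ => ?_
    rw [hadamardOp, tensor, Matrix.of_apply]
    simp only [restrict]
    rw [Finset.prod_coe_sort {Sum.inl i} fun q : Fin n ⊕ R =>
      hadamard ((Sum.elim y w : Bits (Fin n ⊕ R)) q) ((Sum.elim y' w' : Bits (Fin n ⊕ R)) q),
      Finset.prod_singleton]
    rfl
  ext y
  rw [apply_coord]
  simp only [slice]
  rw [Matrix.mul_apply, sum_bits_sum]
  simp only [hent, ite_mul, zero_mul, Finset.sum_ite_eq', Finset.mem_univ, if_true]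

end Slices

end QCode

/-! ### Shallow states near the fattened code have almost certain logical values. -/

namespace QCode

namespace CSSCode

variable {n : ℕ} {C : CSSCode n} {R : Type} [Fintype R] [DecidableEq R]

theorem sum_expect_decodeSign {W : Op (Fin n ⊕ R)}
    (hW : W ∈ Matrix.unitaryGroup (Bits (Fin n ⊕ R)) ℂ) (z : Bits (Fin n)) (t : ℕ) :
    ∑ w, expect (C.decodeSign z t) (slice W w) =
      2 * ∑ y ∈ C.decodeRegion z t 0, outcomeProb W y - 1 := by
  classical
  simp only [decodeSign, expect_diagonal]
  rw [Finset.sum_comm]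
  simp only [← Finset.mul_sum, ← outcomeProb_eq_sum_slice]
  have h : ∀ y, (if y ∈ C.decodeRegion z t 0 then (1 : ℝ) else -1) * outcomeProb W y =
      2 * (if y ∈ C.decodeRegion z t 0 then outcomeProb W y else 0) - outcomeProb W y :=
    fun y => by split_ifs <;> ring
  simp only [h, Finset.sum_sub_distrib, ← Finset.mul_sum, sum_outcomeProb hW,
    Finset.sum_ite_mem, Finset.univ_inter]

/-- If a circuit with small light cones prepares a state close to the fattened code, then the
logical value that is decoded from it is almost certain. -/
theorem le_sq_sum_expect_decodeSign {W : Op (Fin n ⊕ R)} {b : ℕ}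
    {L : Fin n ⊕ R → Finset (Fin n ⊕ R)} (hW : HasLightCones W b L) {z : Bits (Fin n)}
    (hz : z ∈ dual C.Sx) {t : ℕ} (ht : 2 * t < C.minDistance) {μ η : ℝ}
    (hμ : 2 * (n * (b : ℝ) ^ 2) ≤ μ * ((C.minDistance - 2 * t : ℕ) : ℝ) ^ 2)
    {φ : Bits R → Vec (Fin n)} (hφ : ∀ w, φ w ∈ fattening C.codeSpace t)
    (hη : ∑ w, ‖slice W w - φ w‖ ^ 2 ≤ η) :
    1 - 4 * (μ + η) ≤ (∑ w, expect (C.decodeSign z t) (slice W w)) ^ 2 := by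
  classical
  rw [sum_expect_decodeSign hW.unitary]
  set S := C.decodeRegion z t 0 with hS
  set T := C.decodeRegion z t 1 with hT
  set P := ∑ y ∈ S, outcomeProb W y with hP
  set P' := ∑ y ∈ T, outcomeProb W y with hP'
  have hnn : ∀ y, 0 ≤ outcomeProb W y := fun y => Finset.sum_nonneg fun _ _ => by positivity
  have hP0 : 0 ≤ P := Finset.sum_nonneg fun y _ => hnn y
  have hP1 : P ≤ 1 := by
    rw [← sum_outcomeProb hW.unitary]
    exact Finset.sum_le_sum_of_subset_of_nonneg (Finset.subset_univ _) fun y _ _ => hnn y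
  have hdist : ∀ x ∈ S, ∀ y ∈ T, C.minDistance - 2 * t ≤ hammingDist y x := fun x hx y hy => by
    have := minDistance_le_of_mem_decodeRegion hz one_ne_zero hy hx
    omega
  have hdisj : Disjoint S T := by
    refine Finset.disjoint_left.mpr fun y hy hy' => ?_
    have := hdist y hy y hy'
    rw [hammingDist_self] at this
    omega
  have hPP' : P * P' ≤ μ := by
    have h := hW.mass_mul_mass_le S T _ hdist
    rw [Fintype.card_fin] at h
    have hD : 0 < ((C.minDistance - 2 * t : ℕ) : ℝ) ^ 2 := by
      have : 0 < C.minDistance - 2 * t := by omega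
      positivity
    exact le_of_mul_le_mul_right (h.trans hμ) hD
  -- The approximating vectors vanish off `S ∪ T`, so all the mass there is approximation error.
  have hout : 1 - P - P' ≤ η := by
    have hsplit : 1 = ∑ y ∈ S ∪ T, outcomeProb W y + ∑ y ∈ (S ∪ T)ᶜ, outcomeProb W y := by
      rw [Finset.sum_add_sum_compl, sum_outcomeProb hW.unitary]
    rw [Finset.sum_union hdisj] at hsplit
    have h1 : ∑ y ∈ (S ∪ T)ᶜ, outcomeProb W y ≤ ∑ w, ‖slice W w - φ w‖ ^ 2 := by
      simp only [outcomeProb_eq_sum_slice, EuclideanSpace.norm_sq_eq]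
      rw [Finset.sum_comm]
      refine Finset.sum_le_sum fun w _ => ?_
      refine le_trans (le_of_eq (Finset.sum_congr rfl fun y hy => ?_))
        (Finset.sum_le_sum_of_subset_of_nonneg (Finset.subset_univ (S ∪ T)ᶜ)
          fun _ _ _ => by positivity)
      rw [Finset.mem_compl, Finset.mem_union, not_or] at hy
      rw [PiLp.sub_apply, apply_eq_zero_of_mem_fattening (hφ w) hy.1 hy.2, sub_zero]
    linarith
  have hη0 : 0 ≤ η := le_trans (Finset.sum_nonneg fun _ _ => by positivity) hη
  -- Here `P (1 - P) = P P' + P (1 - P - P')`: the first term is small by concentration, the second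
  -- by closeness to the fattening.
  have h1 : P * (1 - P) ≤ μ + η := by
    have : P * (1 - P - P') ≤ η := by
      calc P * (1 - P - P') ≤ P * η := mul_le_mul_of_nonneg_left hout hP0
        _ ≤ 1 * η := mul_le_mul_of_nonneg_right hP1 hη0
        _ = η := one_mul η
    linarith
  linarith [h1, show (2 * P - 1) ^ 2 = 1 - 4 * (P * (1 - P)) by ring]

end CSSCode

/-- The hypotheses are stable under changing the signs of `A` and `B`, so the uncertainty relation
holds for all four choices of signs. -/
theorem abs_sum_expect_add_abs_le {Q ι : Type} [Fintype Q] [DecidableEq Q] [Fintype ι]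
    {A B : Op Q} (hA : Aᴴ = A) (hAA : A * A = 1) (hB : Bᴴ = B) (hBB : B * B = 1)
    {K : Submodule ℂ (Vec Q)} (hAK : ∀ φ ∈ K, apply A φ ∈ K) (hBK : ∀ φ ∈ K, apply B φ ∈ K)
    (hAB : ∀ φ ∈ K, apply A (apply B φ) = - apply B (apply A φ)) (v : ι → Vec Q) :
    |∑ i, expect A (v i)| + |∑ i, expect B (v i)| ≤
      3 / 2 * ∑ i, ‖v i‖ ^ 2 + 2 * ∑ i, ‖v i - K.starProjection (v i)‖ ^ 2 := by
  have hneg : ∀ (M : Op Q) (φ : Vec Q), apply (-M) φ = -apply M φ := fun M φ => by simp [apply]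
  have hvneg : ∀ (M : Op Q) (φ : Vec Q), apply M (-φ) = -apply M φ := fun M φ => map_neg _ _
  have key : ∀ A' B' : Op Q, (A' = A ∨ A' = -A) → (B' = B ∨ B' = -B) →
      ∑ i, expect A' (v i) + ∑ i, expect B' (v i) ≤
        3 / 2 * ∑ i, ‖v i‖ ^ 2 + 2 * ∑ i, ‖v i - K.starProjection (v i)‖ ^ 2 := by
    intro A' B' hA' hB'
    rw [← Finset.sum_add_distrib, Finset.mul_sum, Finset.mul_sum, ← Finset.sum_add_distrib]
    refine Finset.sum_le_sum fun i _ => ?_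
    refine (expect_add_le_of_anticommute (A := A') (B := B') (K := K) ?_ ?_ ?_ ?_ ?_ ?_ ?_
      (v i)).trans ?_
    · rcases hA' with rfl | rfl <;> simp [hA]
    · rcases hA' with rfl | rfl <;> simp [hAA]
    · rcases hB' with rfl | rfl <;> simp [hB]
    · rcases hB' with rfl | rfl <;> simp [hBB]
    · rcases hA' with rfl | rfl
      · exact hAK
      · exact fun φ hφ => by rw [hneg]; exact neg_mem (hAK φ hφ)
    · rcases hB' with rfl | rfl
      · exact hBK
      · exact fun φ hφ => by rw [hneg]; exact neg_mem (hBK φ hφ)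
    · intro φ hφ
      rcases hA' with rfl | rfl <;> rcases hB' with rfl | rfl <;>
        simp only [hneg, hvneg, hAB φ hφ]
    · have := pow_le_pow_left₀ (norm_nonneg _) (K.norm_starProjection_apply_le (v i)) 2
      linarith
  have hsneg : ∀ M : Op Q, ∑ i, expect (-M) (v i) = -∑ i, expect M (v i) := fun M => by
    simp only [expect_neg, Finset.sum_neg_distrib]
  have h1 := key A B (.inl rfl) (.inl rfl)
  have h2 := key A (-B) (.inl rfl) (.inr rfl)
  have h3 := key (-A) B (.inr rfl) (.inl rfl)
  have h4 := key (-A) (-B) (.inr rfl) (.inr rfl)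
  rw [hsneg] at h2 h3 h4
  rw [hsneg] at h4
  rcases abs_cases (∑ i, expect A (v i)) with ⟨ha, -⟩ | ⟨ha, -⟩ <;>
    rcases abs_cases (∑ i, expect B (v i)) with ⟨hb, -⟩ | ⟨hb, -⟩ <;> rw [ha, hb] <;> linarith

/-! ### The contradiction with uncertainty, and the energy bound. -/

namespace CSSCode

variable {n : ℕ} {C : CSSCode n} {R : Type} [Fintype R] [DecidableEq R]

/-- Circuits with small light cones do not prepare states close to a fattened code. -/
theorem lt_sum_dist_fattening {U : Op (Fin n ⊕ R)} {b : ℕ}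
    {L : Fin n ⊕ R → Finset (Fin n ⊕ R)} (hU : HasLightCones U b L)
    (hk : 1 ≤ C.logicalQubits) {t : ℕ} (ht : 2 * t < C.minDistance)
    (hμ : 2 * (n * (b : ℝ) ^ 2) ≤ 1 / 100 * ((C.minDistance - 2 * t : ℕ) : ℝ) ^ 2) :
    1 / 100 < ∑ w, ‖slice U w - (fattening C.codeSpace t).starProjection (slice U w)‖ ^ 2 := by
  by_contra! hη
  obtain ⟨x, hx, z, hz, hxz⟩ := exists_logical_pair hk
  set φ : Bits R → Vec (Fin n) :=
    fun w => (fattening C.codeSpace t).starProjection (slice U w) with hφ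
  have hφK : ∀ w, φ w ∈ fattening C.codeSpace t := fun w => Submodule.starProjection_apply_mem _ _
  have hZ := le_sq_sum_expect_decodeSign hU hz ht hμ hφK hη
  obtain ⟨W, L', hW, hWU⟩ := hU.exists_hadamard
  have hX := le_sq_sum_expect_decodeSign (C := C.swap) (z := x) hW hx
    (t := t) (by rwa [minDistance_swap]) (by rwa [minDistance_swap])
    (fun w => hadamardOp_mem_fattening_swap (hφK w))
    (η := 1 / 100) (by
      refine le_trans (le_of_eq (Finset.sum_congr rfl fun w _ => ?_)) hη
      have : apply (hadamardOp (Fin n)) (slice U w) - apply (hadamardOp (Fin n)) (φ w) =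
        apply (hadamardOp (Fin n)) (slice U w - φ w) := (map_sub _ _ _).symm
      rw [hWU, this, norm_apply_of_involution hadamardOp_conjTranspose hadamardOp_mul_self])
  have hXeq : ∀ w, expect (C.swap.decodeSign x t) (slice W w) =
      expect (C.decodeSignX x t) (slice U w) := fun w => by
    rw [expect, expect, hWU, inner_apply_left, hadamardOp_conjTranspose, decodeSignX, apply_mul,
      apply_mul]
  simp only [hXeq] at hX
  have hle := abs_sum_expect_add_abs_le (decodeSign_conjTranspose (C := C) z t)
    (decodeSign_mul_self z t) (decodeSignX_conjTranspose (C := C) x t) (decodeSignX_mul_self x t)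
    (fun φ hφ => decodeSign_mem_fattening hz ht hφ)
    (fun φ hφ => decodeSignX_mem_fattening hx ht hφ)
    (fun φ hφ => decodeSign_decodeSignX_anticommute hx hz hxz ht hφ) (slice U)
  rw [sum_norm_sq_slice hU.unitary] at hle
  -- Since `0.92 > 0.9 ^ 2`, both expectations exceed `0.9` in absolute value; but their sum may be
  -- at most `3 / 2 + 2 / 100`.
  have habs : ∀ m : ℝ, 1 - 4 * (1 / 100 + 1 / 100) ≤ m ^ 2 → 9 / 10 ≤ |m| := fun m hm => by
    by_contra! h
    have := pow_le_pow_left₀ (abs_nonneg m) h.le 2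
    rw [sq_abs] at this
    norm_num at hm this
    linarith
  linarith [habs _ hZ, habs _ hX, hη]

/-- Low-depth circuits do not prepare low-energy states of locally testable codes. -/
theorem lt_energy_of_isTrivialState {q : ℕ} {ρ δ : ℝ} (hρ : 0 < ρ) (hδ : 0 < δ) (hn : 0 < n)
    (h : C.IsLocallyTestable q ρ) (hk : 1 ≤ C.logicalQubits)
    (hdist : δ * n ≤ C.minDistance) {d : ℕ} (hd : 800 * (2 ^ d : ℝ) ^ 2 ≤ δ ^ 2 * n)
    {σ : Op (Fin n)} (hσ : IsTrivialState d σ) : ρ * δ / 800 < energy C.hamiltonian σ := by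
  obtain ⟨a, U, hU, rfl⟩ := hσ
  obtain ⟨L, hL⟩ := hU.exists_hasLightCones
  have hn' : (0 : ℝ) < n := by exact_mod_cast hn
  have hδn : 0 < δ * n := mul_pos hδ hn'
  -- This `t` leaves a gap of at least `δ n / 2` between the decoding regions, while `t + 1` is
  -- still linear in `n`.
  set t := ⌊δ * n / 4⌋₊ with ht
  have ht1 : (t : ℝ) ≤ δ * n / 4 := Nat.floor_le (by positivity)
  have ht2 : δ * n / 4 ≤ t + 1 := (Nat.lt_floor_add_one _).le
  have htd : 2 * t < C.minDistance := by
    have : (2 * t : ℝ) < C.minDistance := by linarith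
    exact_mod_cast this
  have hD : δ * n / 2 ≤ ((C.minDistance - 2 * t : ℕ) : ℝ) := by
    rw [Nat.cast_sub htd.le]
    push_cast
    linarith
  have hμ : 2 * (n * ((2 ^ d : ℕ) : ℝ) ^ 2) ≤
      1 / 100 * ((C.minDistance - 2 * t : ℕ) : ℝ) ^ 2 := by
    have h1 := pow_le_pow_left₀ (by positivity) hD 2
    have h2 := mul_le_mul_of_nonneg_left hd hn'.le
    push_cast
    nlinarith
  have hfar := lt_sum_dist_fattening hL hk htd hμ
  rw [energy_traceOut]
  have hE : ρ / n * ((t + 1 : ℝ) *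
      ∑ w, ‖slice U w - (fattening C.codeSpace t).starProjection (slice U w)‖ ^ 2) ≤
        2 * ∑ w, expect C.hamiltonian (slice U w) := by
    rw [Finset.mul_sum, Finset.mul_sum, Finset.mul_sum]
    refine Finset.sum_le_sum fun w _ => (mul_le_mul_of_nonneg_left
      (le_expect_distanceOp codeSpace_ne_bot t _) (by positivity)).trans (h.distanceOp_le _)
  have hlow : ρ / n * (δ * n / 4 * (1 / 100)) < ρ / n * ((t + 1 : ℝ) *
      ∑ w, ‖slice U w - (fattening C.codeSpace t).starProjection (slice U w)‖ ^ 2) := by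
    refine mul_lt_mul_of_pos_left ?_ (by positivity)
    exact mul_lt_mul' ht2 hfar (by positivity) (by positivity)
  -- The `800` collects `4` from `t`, `100` from the distance to the fattening and `2` from the
  -- comparison with the Hamiltonian.
  have heq : ρ / n * (δ * n / 4 * (1 / 100)) = 2 * (ρ * δ / 800) := by
    field_simp
    norm_num
  linarith

end CSSCode

/-- Replacing the base `2` by `e` gives `16 ^ d ≤ exp (4 d)`, whence the constant `1 / 4`. -/
theorem two_pow_pow_four_le {n d : ℕ} (hn : 0 < n) (hd : (d : ℝ) < 1 / 4 * Real.log n) :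
    ((2 ^ d : ℝ) ^ 2) ^ 2 ≤ n := by
  have hn' : (0 : ℝ) < n := by exact_mod_cast hn
  have h2 : (2 : ℝ) ≤ Real.exp 1 := by linarith [Real.add_one_le_exp 1]
  calc ((2 ^ d : ℝ) ^ 2) ^ 2 ≤ ((Real.exp 1 ^ d) ^ 2) ^ 2 := by gcongr
    _ = Real.exp (4 * d) := by
      rw [← pow_mul, ← pow_mul, ← Real.exp_nat_mul]
      push_cast
      ring_nf
    _ ≤ Real.exp (Real.log n) := by gcongr; linarith
    _ = n := Real.exp_log hn'

end QCode

theorem mainTheorem4 (ρ δ : ℝ) (hρ : 0 < ρ) (hδ : 0 < δ) :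
    ∃ ε : ℝ, 0 < ε ∧ ∃ c : ℝ, 0 < c ∧
      ∀ (q : ℕ) (n : ℕ → ℕ) (C : ∀ i, QCode.CSSCode (n i)),
        Tendsto n atTop atTop →
        (∀ i, (C i).IsLocallyTestable q ρ) →
        (∀ i, 1 ≤ (C i).logicalQubits) →
        (∀ᶠ i in atTop, δ * (n i : ℝ) ≤ ((C i).minDistance : ℝ)) →
        QCode.IsNLTSWith ε (fun i => (C i).hamiltonian) ∧
        ∀ᶠ i in atTop, ∀ (d : ℕ) (σ : QCode.Op (Fin (n i))),
          QCode.IsTrivialState d σ →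
          QCode.energy (C i).hamiltonian σ ≤ QCode.lambdaMin (C i).hamiltonian + ε →
          c * Real.log (n i) ≤ d := by
  refine ⟨ρ * δ / 800, by positivity, 1 / 4, by norm_num, fun q n C hn hC hk hdist => ?_⟩
  have hnR : Tendsto (fun i => (n i : ℝ)) atTop atTop := tendsto_natCast_atTop_atTop.comp hn
  have hdepth : ∀ᶠ i in atTop, ∀ (d : ℕ) (σ : QCode.Op (Fin (n i))),
      QCode.IsTrivialState d σ →
      QCode.energy (C i).hamiltonian σ ≤ QCode.lambdaMin (C i).hamiltonian + ρ * δ / 800 →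
      1 / 4 * Real.log (n i) ≤ d := by
    filter_upwards [hdist, hn.eventually_gt_atTop 0,
      hnR.eventually_ge_atTop (800 ^ 2 / δ ^ 4)] with i hi hpos hlarge d σ hσ hE
    by_contra! hd
    have hb := QCode.two_pow_pow_four_le hpos hd
    rw [div_le_iff₀ (by positivity)] at hlarge
    -- After squaring, `800 ^ 2 * 16 ^ d ≤ 800 ^ 2 * n ≤ δ ^ 4 * n ^ 2`; the last inequality is the
    -- threshold `800 ^ 2 / δ ^ 4 ≤ n`.
    have hbound : 800 * (2 ^ d : ℝ) ^ 2 ≤ δ ^ 2 * n i := by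
      refine le_of_sq_le_sq ?_ (by positivity)
      have h1 := mul_le_mul_of_nonneg_left hb (by norm_num : (0 : ℝ) ≤ 800 ^ 2)
      have h2 := mul_le_mul_of_nonneg_right hlarge (Nat.cast_nonneg (α := ℝ) (n i))
      linarith [mul_pow (800 : ℝ) ((2 ^ d : ℝ) ^ 2) 2,
        show (δ ^ 2 * (n i : ℝ)) ^ 2 = n i * δ ^ 4 * n i by ring]
    have h1 := QCode.CSSCode.lt_energy_of_isTrivialState hρ hδ hpos (hC i) (hk i) hi hbound hσ
    linarith [QCode.CSSCode.lambdaMin_hamiltonian_nonpos (C := C i)]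
  -- The NLTS property follows from the depth bound, as a constant depth is eventually below `log n
  -- / 4`.
  refine ⟨⟨hn, ⟨q + q, fun i => (hC i).isLocalHamiltonian⟩, fun d σ hσ => ?_⟩, hdepth⟩
  filter_upwards [hdepth, hσ,
    (Real.tendsto_log_atTop.comp hnR).eventually_gt_atTop (4 * (d : ℝ))] with i hi hσi hlog
  by_contra! hE
  have := hi d (σ i) hσi hE
  simp only [Function.comp_apply] at hlog
  linarith
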